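/- There is a universal constant $c>0$ such that the following holds for all reals $D>0$, $G>0$, $\mu>0$, $p\in(1,2]$, $0<\sigma_s\le\sigma_l$, all integers $d\ge d_{\mathrm{eff}}:=\sigma_l^2/\sigma_s^2$ and $T\ge1$, and all $\delta\in(0,\tfrac1{10})$: \[ R_\star^{\mathrm{str}}(\delta)\;\ge\; c\,\min\left\{\mu D^2,\ \frac{G^2}{\mu},\ \frac{\sigma_s^{\frac4p-2}\sigma_l^{4-\frac4p}}{\mu},\ \frac{\sigma_s^{\frac4p-2}\sigma_l^{4-\frac4p}+\sigma_s^2\ln^{2-\frac2p}\frac1{8\delta}}{\mu\,T^{2-\frac2p}}\right\}. \] Here the minimax error $R_\star^{\mathrm{str}}(\delta)\in[0,\infty]$ is defined as follows. Let $\mathfrak f_G$ be the set of convex functions $f:\mathbb R^d\to\mathbb R$ that are $G$-Lipschitz for the Euclidean norm, and let $r(x)=\frac\mu2\|x\|^2$. Let $\mathfrak F$ be the set of functions $F=f+r$ with $f\in\mathfrak f_G$ and $\inf_{x_\star\in\arg\min F}\|x_\star\|\le D$ (the infimum of the empty set being $+\infty$). Put $F_\star=\inf_{x\in\mathbb R^d}F(x)$.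 An oracle $g\in\mathcal G$ assigns to each $f\in\mathfrak f_G$ and $x\in\mathbb R^d$ a random vector $g(x,f)\in\mathbb R^d$, drawn with fresh independent randomness at each query, whose law depends measurably on $x$ (i.e. is a Markov kernel in $x$), such that for all $f\in\mathfrak f_G$ and $x\in\mathbb R^d$ the vector $g(x,f)$ is integrable, its mean $\nabla f(x):=\mathbb E[g(x,f)]$ is a subgradient of $f$ at $x$, $\mathbb E[|\langle e,g(x,f)-\nabla f(x)\rangle|^p]\le\sigma_s^p$ for every unit vector $e$, and $\mathbb E[\|g(x,f)-\nabla f(x)\|^p]\le\sigma_l^p$. A (deterministic) algorithm $A\in\mathcal A_T$ is a family of measurable maps $A_t:(\mathbb R^d)^t\to\mathbb R^d$, $0\le t\le T$; it may depend on the known function $r$. Run with oracle $g$ on $F=f+r$, it starts from $x_1=A_0$, and for $t=1,\dots,T$ it observes $g_t=g(x_t,f)$ and sets $x_{t+1}=A_t(g_1,\dots,g_t)$. Finally, \[ R_\star^{\mathrm{str}}(\delta)=\sup_{g\in\mathcal G}\ \inf_{A\in\mathcal A_T}\ \sup_{F\in\mathfrak F}\ \inf\bigl\{\epsilon\ge0:\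 \Pr[F(x_{T+1})-F_\star>\epsilon]\le\delta\bigr\}. \] -/

import Mathlib

open MeasureTheory ProbabilityTheory
open scoped ENNReal NNReal

noncomputable section

namespace HeavyTailLB

/-- The Euclidean space `ℝᵈ`. -/
abbrev Vec (d : ℕ) : Type := EuclideanSpace ℝ (Fin d)

/-- The class of convex and `G`-Lipschitz functions on `ℝᵈ`. -/
def lipConvex (d : ℕ) (G : ℝ) : Set (Vec d → ℝ) :=
  {f | ConvexOn ℝ Set.univ f ∧ ∀ x y, |f x - f y| ≤ G * ‖x - y‖}

/-- The set of subgradients of `f` at `x`. -/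
def subgradients {d : ℕ} (f : Vec d → ℝ) (x : Vec d) : Set (Vec d) :=
  {v | ∀ y, f x + inner ℝ v (y - x) ≤ f y}

/-- The set of global minimizers of `F`. -/
def argmin {d : ℕ} (F : Vec d → ℝ) : Set (Vec d) :=
  {x | ∀ y, F x ≤ F y}

/-- The regularizer `r(x) = (μ/2)‖x‖²`. -/
def reg (d : ℕ) (μ : ℝ) : Vec d → ℝ := fun x => μ / 2 * ‖x‖ ^ 2

/-- The class of objectives `F = f + (μ/2)‖·‖²`, with `f` convex and `G`-Lipschitz, for which the
infimum of `‖x⋆‖` over the minimizers `x⋆` of `F` is at most `D`. The infimum is taken in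
`[0, ∞]`, so that it is `∞` when there is no minimizer. -/
def strClass (d : ℕ) (D G μ : ℝ) : Set (Vec d → ℝ) :=
  {F | (∃ f ∈ lipConvex d G, F = f + reg d μ) ∧
    (⨅ x ∈ argmin F, ENNReal.ofReal ‖x‖) ≤ ENNReal.ofReal D}

/-- Stochastic first-order oracles. `law f x` is the distribution of the random vector `g(x, f)`
that is returned by a query at `x` (fresh randomness is used for every query). Its mean is a
subgradient `∇f(x)` of `f` at `x`, and the error `g(x, f) - ∇f(x)` has `p`-th absolute moment at
most `σs ^ p` in every unit direction, and `p`-th moment of its norm at most `σl ^ p`. -/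
structure Oracle (d : ℕ) (G p σs σl : ℝ) where
  law : lipConvex d G → Kernel (Vec d) (Vec d)
  isMarkov : ∀ f, IsMarkovKernel (law f)
  moments : ∀ (f : lipConvex d G) (x : Vec d), ∃ v ∈ subgradients f.1 x,
    Integrable (fun y => y) (law f x) ∧ ∫ y, y ∂(law f x) = v ∧
    (∀ e : Vec d, ‖e‖ = 1 →
      ∫⁻ y, ENNReal.ofReal (|inner ℝ e (y - v)| ^ p) ∂(law f x) ≤ ENNReal.ofReal (σs ^ p)) ∧
    ∫⁻ y, ENNReal.ofReal (‖y - v‖ ^ p) ∂(law f x) ≤ ENNReal.ofReal (σl ^ p)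

/-- Deterministic algorithms with `T` iterations: measurable maps `A₀, …, A_T`, where `A_t` maps
the observed stochastic gradients `(g₁, …, g_t)` to the next iterate `x_{t+1}`. The regularizer is
a fixed known function, so the maps may depend on it freely. -/
structure Algorithm (d T : ℕ) where
  step : (t : Fin (T + 1)) → (Fin t → Vec d) → Vec d
  measurable_step : ∀ t, Measurable (step t)

/-- The joint distribution of the first `t` observed stochastic gradients `(g₁, …, g_t)`, when
`g_{s+1}` is drawn, given `g₁, …, g_s`, from `κ` at the iterate `x_{s+1} = A_s(g₁, …, g_s)`. -/
def gradLaw {d T : ℕ} (A : Algorithm d T) (κ : Kernel (Vec d) (Vec d)) :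
    (t : ℕ) → t ≤ T → Measure (Fin t → Vec d)
  | 0, _ => Measure.dirac Fin.elim0
  | t + 1, h =>
      (gradLaw A κ t (by omega) ⊗ₘ
        κ.comap (A.step ⟨t, by omega⟩) (A.measurable_step ⟨t, by omega⟩)).map
        (fun z => (Fin.snoc z.1 z.2 : Fin (t + 1) → Vec d))

/-- The distribution of the output `x_{T+1} = A_T(g₁, …, g_T)`. -/
def outputLaw {d T : ℕ} (A : Algorithm d T) (κ : Kernel (Vec d) (Vec d)) : Measure (Vec d) :=
  (gradLaw A κ T le_rfl).map (A.step (Fin.last T))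

/-- `inf {ε ≥ 0 : Pr[F(x) - inf F > ε] ≤ δ}` when `x` has distribution `ν`. -/
def errorQuantile {d : ℕ} (F : Vec d → ℝ) (ν : Measure (Vec d)) (δ : ℝ) : ℝ≥0∞ :=
  ⨅ (ε : ℝ≥0) (_ : ν {x | (ε : ℝ) < F x - ⨅ y, F y} ≤ ENNReal.ofReal δ), (ε : ℝ≥0∞)

/-- The high-probability minimax error for strongly convex problems: the supremum over the oracles,
of the infimum over the algorithms, of the supremum over the objectives
`F = f + (μ/2)‖·‖²` of the class, of the `δ`-quantile of the error of the output. -/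
def minimaxStr (d T : ℕ) (D G μ p σs σl δ : ℝ) : ℝ≥0∞ :=
  ⨆ g : Oracle d G p σs σl, ⨅ A : Algorithm d T,
    ⨆ (f : lipConvex d G) (_ : f.1 + reg d μ ∈ strClass d D G μ),
      errorQuantile (f.1 + reg d μ) (outputLaw A (g.law f)) δ

end HeavyTailLB

end

/-! The hard objectives are `F = ⟨s·u, x⟩ + (μ/2)‖x‖²`, where `u` is a fixed vector and `s` ranges
over all sign patterns of its coordinates. Completing the square gives the gap `‖μx + s·u‖² / (2μ)`,
so optimizing means estimating the signs. The oracle ignores the query point: it returns `s·y` with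
`y` drawn from a "mask", a law of mean `u` that hides each coordinate (returns zero there) with
substantial probability. The observations are therefore i.i.d. whatever the algorithm does.

Flipping the signs of coordinates hidden in all `T` rounds leaves the observations unchanged. By the
parallelogram law, the squared error is at least the unseen mass (the sum of `u i ^ 2` over unseen
coordinates) for one of the two sign patterns. Averaging over all `s` gives a fixed `s` with large
error on an event of at least half the probability (`exists_large_error`, `le_minimaxStr`).

Two masks give the two terms of the rate. For the dimension term, `u` is constant on about `σl² /
σs²` coordinates, each revealed with probability at most `1/(4T)`; Markov's inequality leaves half
the mass unseen with probability at least `1/2` (`spread_le_minimaxStr`). For the confidence term,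
`u` has one coordinate, hidden throughout with probability at least `8δ`
(`confidence_le_minimaxStr`). The rest is moment bounds, which decide how large `u` may be.

An oracle must also answer on every other convex Lipschitz function, measurably in the query point.
It answers there with exact subgradients, which requires a measurable selection
(`exists_measurable_subgradient`). -/

noncomputable section

namespace HeavyTailLB

/-! ### Measurable selection of subgradients -/

/-- Subadditive and positively homogeneous functions. -/
structure IsSublinear {d : ℕ} (h : Vec d → ℝ) : Prop where
  add_le : ∀ x y, h (x + y) ≤ h x + h y
  smul_le : ∀ (c : ℝ) (x : Vec d), 0 < c → h (c • x) ≤ c * h x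

namespace IsSublinear

variable {d : ℕ} {h : Vec d → ℝ}

lemma map_zero (hh : IsSublinear h) : h 0 = 0 := by
  have h1 := hh.add_le 0 0
  have h2 := hh.smul_le (1 / 2) 0 (by norm_num)
  simp only [add_zero, smul_zero] at h1 h2
  linarith

lemma smul_eq (hh : IsSublinear h) {c : ℝ} (hc : 0 ≤ c) (x : Vec d) : h (c • x) = c * h x := by
  rcases hc.eq_or_lt with rfl | hc
  · simp [hh.map_zero]
  · refine le_antisymm (hh.smul_le c x hc) ?_
    have h1 := hh.smul_le c⁻¹ (c • x) (inv_pos.2 hc)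
    rw [smul_smul, inv_mul_cancel₀ hc.ne', one_smul] at h1
    calc c * h x ≤ c * (c⁻¹ * h (c • x)) := by gcongr
      _ = h (c • x) := by field_simp

/-- The directional derivative of a sublinear function at `e`. -/
def deriv (h : Vec d → ℝ) (e y : Vec d) : ℝ := ⨅ t : ℝ≥0, (h ((t : ℝ) • e + y) - t * h e)

lemma neg_le (hh : IsSublinear h) (x : Vec d) : -h (-x) ≤ h x := by
  have h1 := hh.add_le x (-x)
  rw [add_neg_cancel, hh.map_zero] at h1
  linarith

lemma deriv_bound (hh : IsSublinear h) (e y : Vec d) (t : ℝ≥0) :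
    -h (-y) ≤ h ((t : ℝ) • e + y) - t * h e := by
  have h1 := hh.add_le ((t : ℝ) • e + y) (-y)
  rw [add_neg_cancel_right, hh.smul_eq t.coe_nonneg] at h1
  linarith

lemma deriv_bddBelow (hh : IsSublinear h) (e y : Vec d) :
    BddBelow (Set.range fun t : ℝ≥0 => h ((t : ℝ) • e + y) - t * h e) :=
  ⟨-h (-y), by rintro _ ⟨t, rfl⟩; exact hh.deriv_bound e y t⟩

lemma deriv_le (hh : IsSublinear h) (e y : Vec d) (t : ℝ≥0) :
    deriv h e y ≤ h ((t : ℝ) • e + y) - t * h e :=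
  ciInf_le (hh.deriv_bddBelow e y) t

lemma deriv_le_self (hh : IsSublinear h) (e y : Vec d) : deriv h e y ≤ h y := by
  simpa using hh.deriv_le e y 0

lemma deriv_isSublinear (hh : IsSublinear h) (e : Vec d) : IsSublinear (deriv h e) where
  add_le x y := by
    refine le_ciInf_add_ciInf fun t s => ?_
    refine (hh.deriv_le e (x + y) (t + s)).trans ?_
    have h1 := hh.add_le ((t : ℝ) • e + x) ((s : ℝ) • e + y)
    have h2 : ((t + s : ℝ≥0) : ℝ) • e + (x + y) = (t : ℝ) • e + x + ((s : ℝ) • e + y) := by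
      push_cast; module
    rw [h2]; push_cast; linarith
  smul_le c x hc := by
    rw [deriv, deriv, Real.mul_iInf_of_nonneg hc.le]
    refine le_ciInf fun t => ?_
    refine (hh.deriv_le e (c • x) (c.toNNReal * t)).trans (le_of_eq ?_)
    rw [NNReal.coe_mul, Real.coe_toNNReal c hc.le]
    have h2 : (c * (t : ℝ)) • e + c • x = c • ((t : ℝ) • e + x) := by module
    rw [h2, hh.smul_eq hc.le]
    ring

/-- Take `t = 0` at `e` and `t = 1` at `-e`; the latter gives `h 0 - h e = -h e`. Thus passing to
the derivative makes the function linear along the axis of `e`. -/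
lemma deriv_add_neg_le (hh : IsSublinear h) (e : Vec d) : deriv h e e + deriv h e (-e) ≤ 0 := by
  have h1 := hh.deriv_le_self e e
  have h2 := hh.deriv_le e (-e) 1
  simp [hh.map_zero] at h2
  linarith

/-- By subadditivity the expression under the infimum is nonincreasing in `t`, so integers suffice.
A countable infimum preserves measurability in a parameter. -/
lemma deriv_eq_iInf_nat (hh : IsSublinear h) (e y : Vec d) :
    deriv h e y = ⨅ n : ℕ, (h ((n : ℝ) • e + y) - n * h e) := by
  refine le_antisymm (le_ciInf fun n => by simpa using hh.deriv_le e y n) (le_ciInf fun t => ?_)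
  obtain ⟨n, hn⟩ := exists_nat_ge t
  have hb : BddBelow (Set.range fun n : ℕ => h ((n : ℝ) • e + y) - n * h e) :=
    ⟨-h (-y), by rintro _ ⟨n, rfl⟩; simpa using hh.deriv_bound e y n⟩
  refine (ciInf_le hb n).trans ?_
  have hn' : (t : ℝ) ≤ n := by exact_mod_cast hn
  have h1 := hh.add_le ((t : ℝ) • e + y) (((n : ℝ) - t) • e)
  rw [hh.smul_eq (sub_nonneg.2 hn')] at h1
  have h2 : (t : ℝ) • e + y + ((n : ℝ) - t) • e = (n : ℝ) • e + y := by module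
  rw [h2] at h1
  linarith

/-- A sublinear function that is linear on all coordinate axes dominates a linear function. -/
lemma inner_le (hh : IsSublinear h)
    (hlin : ∀ i, h (EuclideanSpace.single i 1) + h (-EuclideanSpace.single i 1) ≤ 0) (y : Vec d) :
    inner ℝ (WithLp.toLp 2 fun i => h (EuclideanSpace.single i 1) : Vec d) y ≤ h y := by
  have haxis : ∀ (c : ℝ) (i : Fin d),
      h (c • EuclideanSpace.single i 1) ≤ c * h (EuclideanSpace.single i 1) := by
    intro c i
    rcases le_total 0 c with hc | hc
    · exact (hh.smul_eq hc _).le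
    · have h1 := hh.smul_eq (neg_nonneg.2 hc) (-EuclideanSpace.single i 1)
      rw [smul_neg, neg_smul, neg_neg] at h1
      rw [h1]
      nlinarith [hlin i]
  have hsum : ∀ s : Finset (Fin d), ∀ z : Fin d → Vec d, h (∑ i ∈ s, z i) ≤ ∑ i ∈ s, h (z i) := by
    intro s z
    induction s using Finset.induction_on with
    | empty => simp [hh.map_zero]
    | insert i s hi ih =>
      rw [Finset.sum_insert hi, Finset.sum_insert hi]
      exact (hh.add_le _ _).trans (by gcongr)
  -- An upper bound for `h (-y)` is enough, because `-h (-y) ≤ h y`.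
  have hy : -y = ∑ i, (-y i) • (EuclideanSpace.single i 1 : Vec d) := by
    ext j
    simp [Finset.sum_apply, Pi.single_apply]
  have h1 : h (-y) ≤ ∑ i, -y i * h (EuclideanSpace.single i 1) := by
    rw [hy]
    exact (hsum _ _).trans (Finset.sum_le_sum fun i _ => haxis _ _)
  have h2 : inner ℝ (WithLp.toLp 2 fun i => h (EuclideanSpace.single i 1) : Vec d) y
      = -∑ i, -y i * h (EuclideanSpace.single i 1) := by
    simp [PiLp.inner_apply]
  rw [h2]
  linarith [hh.neg_le y]

/-- A measurable family of sublinear functions can be decreased to a measurable family of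
sublinear functions that are linear on prescribed axes. -/
lemma exists_measurable_linear_on {X : Type*} [MeasurableSpace X] {H : X → Vec d → ℝ}
    (hH : ∀ x, IsSublinear (H x)) (hm : ∀ y, Measurable fun x => H x y) (s : Finset (Fin d)) :
    ∃ K : X → Vec d → ℝ, (∀ x, IsSublinear (K x)) ∧ (∀ y, Measurable fun x => K x y) ∧
      (∀ x y, K x y ≤ H x y) ∧
      ∀ x, ∀ i ∈ s, K x (EuclideanSpace.single i 1) + K x (-EuclideanSpace.single i 1) ≤ 0 := by
  induction s using Finset.induction_on with
  | empty => exact ⟨H, hH, hm, fun _ _ => le_rfl, by simp⟩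
  | insert i s hi ih =>
    obtain ⟨K, hK, hKm, hKH, hKs⟩ := ih
    refine ⟨fun x => deriv (K x) (EuclideanSpace.single i 1), fun x => (hK x).deriv_isSublinear _,
      fun y => ?_, fun x y => ((hK x).deriv_le_self _ y).trans (hKH x y), fun x j hj => ?_⟩
    · simp only [(hK _).deriv_eq_iInf_nat]
      exact Measurable.iInf fun n => (hKm _).sub ((hKm _).const_mul _)
    -- Differentiating only decreases the function, so axes treated earlier stay linear.
    · rcases Finset.mem_insert.1 hj with rfl | hj
      · exact (hK x).deriv_add_neg_le _
      · exact (add_le_add ((hK x).deriv_le_self _ _) ((hK x).deriv_le_self _ _)).trans (hKs x j hj)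

end IsSublinear

/-- The one-sided directional derivative of a convex function. -/
def dirDeriv {d : ℕ} (f : Vec d → ℝ) (x y : Vec d) : ℝ :=
  ⨅ t : Set.Ioi (0 : ℝ), (f (x + (t : ℝ) • y) - f x) / t

section dirDeriv

variable {d : ℕ} {G : ℝ} {f : Vec d → ℝ}

lemma dirDeriv_bddBelow (hf : f ∈ lipConvex d G) (x y : Vec d) :
    BddBelow (Set.range fun t : Set.Ioi (0 : ℝ) => (f (x + (t : ℝ) • y) - f x) / t) := by
  refine ⟨-(G * ‖y‖), ?_⟩
  rintro _ ⟨⟨t, ht⟩, rfl⟩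
  have ht : 0 < t := ht
  have h1 := hf.2 (x + t • y) x
  rw [add_sub_cancel_left, norm_smul, Real.norm_of_nonneg ht.le] at h1
  have h2 := (abs_le.1 h1).1
  rw [le_div_iff₀ ht]
  linarith

lemma dirDeriv_le (hf : f ∈ lipConvex d G) (x y : Vec d) {t : ℝ} (ht : 0 < t) :
    dirDeriv f x y ≤ (f (x + t • y) - f x) / t :=
  ciInf_le (dirDeriv_bddBelow hf x y) ⟨t, ht⟩

lemma dirDeriv_isSublinear (hf : f ∈ lipConvex d G) (x : Vec d) :
    IsSublinear (dirDeriv f x) where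
  add_le y z := by
    have : Nonempty (Set.Ioi (0 : ℝ)) := ⟨⟨1, Set.mem_Ioi.2 one_pos⟩⟩
    refine le_ciInf_add_ciInf ?_
    rintro ⟨t, ht⟩ ⟨s, hs⟩
    have ht : 0 < t := ht
    have hs : 0 < s := hs
    have hts : 0 < t + s := by positivity
    -- With this step, `x + r • (y + z)` is the convex combination of `x + t • y` and `x + s • z`
    -- with weights `s / (t + s)` and `t / (t + s)`.
    have hr : 0 < t * s / (t + s) := by positivity
    refine (dirDeriv_le hf x (y + z) hr).trans ?_
    have h1 : f ((s / (t + s)) • (x + t • y) + (t / (t + s)) • (x + s • z))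
        ≤ (s / (t + s)) • f (x + t • y) + (t / (t + s)) • f (x + s • z) :=
      hf.1.2 trivial trivial (by positivity) (by positivity) (by field_simp; ring)
    have h2 : (s / (t + s)) • (x + t • y) + (t / (t + s)) • (x + s • z)
        = x + (t * s / (t + s)) • (y + z) := by
      have h3 : x = (s / (t + s)) • x + (t / (t + s)) • x := by
        rw [← add_smul, ← add_div, add_comm s t, div_self hts.ne', one_smul]
      conv_rhs => rw [h3]
      simp only [smul_add, smul_smul]
      rw [show s / (t + s) * t = t * s / (t + s) by ring,
        show t / (t + s) * s = t * s / (t + s) by ring]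
      abel
    rw [h2] at h1
    rw [div_le_iff₀ hr]
    simp only [smul_eq_mul] at h1
    calc _ ≤ s / (t + s) * f (x + t • y) + t / (t + s) * f (x + s • z) - f x := by linarith
      _ = _ := by field_simp; ring
  smul_le c y hc := by
    have : Nonempty (Set.Ioi (0 : ℝ)) := ⟨⟨1, Set.mem_Ioi.2 one_pos⟩⟩
    rw [dirDeriv, dirDeriv, Real.mul_iInf_of_nonneg hc.le]
    refine le_ciInf ?_
    rintro ⟨t, ht⟩
    have ht : 0 < t := ht
    refine (dirDeriv_le hf x (c • y) (div_pos ht hc)).trans (le_of_eq ?_)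
    rw [smul_smul, div_mul_cancel₀ _ hc.ne']
    field_simp

lemma continuous_of_mem_lipConvex (hf : f ∈ lipConvex d G) : Continuous f := by
  refine (LipschitzWith.of_dist_le_mul (K := Real.toNNReal G) fun x y => ?_).continuous
  rw [Real.dist_eq, dist_eq_norm]
  exact (hf.2 x y).trans (by gcongr; exact Real.le_coe_toNNReal G)

/-- For each fixed step the difference quotient is continuous in `x`, so the infimum is upper
semicontinuous. -/
lemma measurable_dirDeriv (hf : f ∈ lipConvex d G) (y : Vec d) :
    Measurable fun x => dirDeriv f x y := by
  have hc := continuous_of_mem_lipConvex hf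
  refine UpperSemicontinuous.measurable ?_
  refine upperSemicontinuous_ciInf (fun x => dirDeriv_bddBelow hf x y) fun t => ?_
  refine Continuous.upperSemicontinuous ?_
  fun_prop

/-- Convex Lipschitz functions have a measurable selection of subgradients. -/
theorem exists_measurable_subgradient (hf : f ∈ lipConvex d G) :
    ∃ v : Vec d → Vec d, Measurable v ∧ ∀ x, v x ∈ subgradients f x := by
  obtain ⟨K, hK, hKm, hKf, hlin⟩ := IsSublinear.exists_measurable_linear_on
    (dirDeriv_isSublinear hf) (measurable_dirDeriv hf) Finset.univ
  refine ⟨fun x => WithLp.toLp 2 fun i => K x (EuclideanSpace.single i 1), ?_, fun x y => ?_⟩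
  · exact (WithLp.measurable_toLp 2 _).comp (measurable_pi_lambda _ fun i => hKm _)
  · have h1 := (hK x).inner_le (fun i => hlin x i (Finset.mem_univ i)) (y - x)
    have h2 := (hKf x (y - x)).trans (dirDeriv_le hf x (y - x) one_pos)
    simp only [one_smul, add_sub_cancel, div_one] at h2
    linarith

end dirDeriv

/-! ### Hard instances: sign changes of a linear function -/

/-- The isometry that multiplies the coordinates by given signs. -/
def signMap {d : ℕ} (s : Fin d → ℤˣ) : Vec d →ₗᵢ[ℝ] Vec d where
  toFun x := WithLp.toLp 2 fun i => ((s i : ℤ) : ℝ) * x i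
  map_add' x y := by ext i; simp [mul_add]
  map_smul' c x := by ext i; simp; ring
  norm_map' x := by
    simp only [LinearMap.coe_mk, AddHom.coe_mk, EuclideanSpace.norm_eq]
    congr 1
    refine Finset.sum_congr rfl fun i _ => ?_
    rcases Int.units_eq_one_or (s i) with h | h <;> simp [h]

section signMap

variable {d : ℕ}

@[simp] lemma signMap_apply (s : Fin d → ℤˣ) (x : Vec d) (i : Fin d) :
    signMap s x i = ((s i : ℤ) : ℝ) * x i := rfl

lemma signMap_signMap (s : Fin d → ℤˣ) (x : Vec d) : signMap s (signMap s x) = x := by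
  ext i
  rcases Int.units_eq_one_or (s i) with h | h <;> simp [h]

lemma inner_signMap (s : Fin d → ℤˣ) (x y : Vec d) :
    inner ℝ x (signMap s y) = inner ℝ (signMap s x) y := by
  rw [← (signMap s).inner_map_map x, signMap_signMap]

lemma measurable_signMap (s : Fin d → ℤˣ) : Measurable (signMap s) :=
  (signMap s).continuous.measurable

end signMap

/-- Linear functions. -/
def linFun {d : ℕ} (v : Vec d) : Vec d → ℝ := fun x => inner ℝ v x

section linFun

variable {d : ℕ} {G D μ : ℝ} {v : Vec d}

lemma linFun_injective : Function.Injective (linFun (d := d)) := fun _ _ h =>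
  ext_inner_right ℝ fun x => congrFun h x

lemma linFun_mem_lipConvex (hv : ‖v‖ ≤ G) : linFun v ∈ lipConvex d G := by
  refine ⟨(innerₛₗ ℝ v).convexOn convex_univ, fun x y => ?_⟩
  simp only [linFun]
  rw [← inner_sub_right]
  exact (abs_real_inner_le_norm _ _).trans (by gcongr)

lemma mem_subgradients_linFun (x : Vec d) : v ∈ subgradients (linFun v) x := fun y => by
  simp [linFun, inner_sub_right]

lemma linFun_add_reg (hμ : 0 < μ) (x : Vec d) :
    (linFun v + reg d μ) x = ‖μ • x + v‖ ^ 2 / (2 * μ) - ‖v‖ ^ 2 / (2 * μ) := by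
  rw [norm_add_sq_real, norm_smul, Real.norm_of_nonneg hμ.le, inner_smul_left]
  simp only [Pi.add_apply, linFun, reg, real_inner_comm x v]
  simp only [conj_trivial]
  field_simp
  ring

lemma linFun_add_reg_min (hμ : 0 < μ) :
    (linFun v + reg d μ) (-(μ⁻¹ • v)) = -(‖v‖ ^ 2 / (2 * μ)) := by
  rw [linFun_add_reg hμ, smul_neg, smul_smul, mul_inv_cancel₀ hμ.ne']
  simp

lemma linFun_add_reg_ge (hμ : 0 < μ) (x : Vec d) :
    -(‖v‖ ^ 2 / (2 * μ)) ≤ (linFun v + reg d μ) x := by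
  rw [linFun_add_reg hμ]
  have : 0 ≤ ‖μ • x + v‖ ^ 2 / (2 * μ) := by positivity
  linarith

/-- Completing the square: a small gap at `x` means that `μ • x` is a good estimate of `-v`. -/
lemma linFun_gap (hμ : 0 < μ) (x : Vec d) :
    (linFun v + reg d μ) x - ⨅ y, (linFun v + reg d μ) y = ‖μ • x + v‖ ^ 2 / (2 * μ) := by
  have h1 : ⨅ y, (linFun v + reg d μ) y = -(‖v‖ ^ 2 / (2 * μ)) := by
    refine le_antisymm ?_ (le_ciInf fun y => linFun_add_reg_ge hμ y)
    rw [← linFun_add_reg_min hμ]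
    exact ciInf_le ⟨_, by rintro _ ⟨y, rfl⟩; exact linFun_add_reg_ge hμ y⟩ _
  rw [h1, linFun_add_reg hμ]
  ring

lemma linFun_add_reg_mem_strClass (hμ : 0 < μ) (hG : ‖v‖ ≤ G) (hD : ‖v‖ ≤ μ * D) :
    linFun v + reg d μ ∈ strClass d D G μ := by
  refine ⟨⟨_, linFun_mem_lipConvex hG, rfl⟩, ?_⟩
  refine iInf₂_le_of_le (-(μ⁻¹ • v)) (fun y => ?_) (ENNReal.ofReal_le_ofReal ?_)
  · rw [linFun_add_reg_min hμ]
    exact linFun_add_reg_ge hμ y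
  · rw [norm_neg, norm_smul, Real.norm_of_nonneg (inv_pos.2 hμ).le, inv_mul_le_iff₀ hμ]
    exact hD

end linFun

/-! ### Masks and the oracles built from them -/

/-- Admissible distributions of a stochastic gradient with mean `u`. -/
structure IsMask {d : ℕ} (P : Measure (Vec d)) (u : Vec d) (p σs σl : ℝ) : Prop where
  isProb : IsProbabilityMeasure P
  integrable : Integrable (fun y => y) P
  mean : ∫ y, y ∂P = u
  dir : ∀ e : Vec d, ‖e‖ = 1 →
    ∫⁻ y, ENNReal.ofReal (|inner ℝ e (y - u)| ^ p) ∂P ≤ ENNReal.ofReal (σs ^ p)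
  norm : ∫⁻ y, ENNReal.ofReal (‖y - u‖ ^ p) ∂P ≤ ENNReal.ofReal (σl ^ p)
  support : ∀ᵐ y ∂P, ∀ i, u i = 0 → y i = 0

namespace IsMask

variable {d : ℕ} {P : Measure (Vec d)} {u : Vec d} {D G μ p σs σl δ : ℝ}

/-- The objective does not determine the signs where `u` vanishes. The clause `support` makes these
signs irrelevant to the answer, so that the oracle is a function of the objective alone. -/
lemma map_signMap_congr (hP : IsMask P u p σs σl) {s s' : Fin d → ℤˣ}
    (h : signMap s u = signMap s' u) : P.map (signMap s) = P.map (signMap s') := by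
  refine Measure.map_congr ?_
  filter_upwards [hP.support] with y hy
  ext i
  by_cases hi : u i = 0
  · simp [hy i hi]
  · have h1 := congrArg (fun z : Vec d => z i) h
    simp only [signMap_apply] at h1 ⊢
    rw [mul_right_cancel₀ hi h1]

lemma map_signMap (hP : IsMask P u p σs σl) (s : Fin d → ℤˣ) :
    IsMask (P.map (signMap s)) (signMap s u) p σs σl := by
  have := hP.isProb
  have hm := measurable_signMap s
  have hemb := (signMap s).isometry.isClosedEmbedding.measurableEmbedding
  refine ⟨Measure.isProbabilityMeasure_map hm.aemeasurable, ?_, ?_, fun e he => ?_, ?_, ?_⟩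
  · rw [hemb.integrable_map_iff]
    exact (signMap s).toContinuousLinearMap.integrable_comp hP.integrable
  · rw [hemb.integral_map]
    have := (signMap s).toContinuousLinearMap.integral_comp_comm hP.integrable
    rw [hP.mean] at this
    exact this
  · rw [hemb.lintegral_map]
    simp_rw [← map_sub, inner_signMap]
    exact hP.dir _ (by rw [LinearIsometry.norm_map, he])
  · rw [hemb.lintegral_map]
    simp_rw [← map_sub, LinearIsometry.norm_map]
    exact hP.norm
  · rw [hemb.ae_map_iff]
    filter_upwards [hP.support] with y hy i hi
    simp only [signMap_apply, mul_eq_zero, Int.cast_eq_zero, Units.ne_zero, false_or] at hi ⊢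
    exact hy i hi

/-- An oracle that answers with a sign change of the given mask on the linear functions with
slope a sign change of `u`, and with exact subgradients on all other functions. -/
lemma exists_oracle (hP : IsMask P u p σs σl) (hp : 0 < p) :
    ∃ g : Oracle d G p σs σl, ∀ (s : Fin d → ℤˣ) (hs : linFun (signMap s u) ∈ lipConvex d G),
      g.law ⟨_, hs⟩ = Kernel.const _ (P.map (signMap s)) := by
  classical
  have hex : ∀ f : lipConvex d G, ∃ κ : Kernel (Vec d) (Vec d), IsMarkovKernel κ ∧
      (∀ x, ∃ v ∈ subgradients f.1 x, Integrable (fun y => y) (κ x) ∧ ∫ y, y ∂(κ x) = v ∧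
        (∀ e : Vec d, ‖e‖ = 1 →
          ∫⁻ y, ENNReal.ofReal (|inner ℝ e (y - v)| ^ p) ∂(κ x) ≤ ENNReal.ofReal (σs ^ p)) ∧
        ∫⁻ y, ENNReal.ofReal (‖y - v‖ ^ p) ∂(κ x) ≤ ENNReal.ofReal (σl ^ p)) ∧
      ∀ s, f.1 = linFun (signMap s u) → κ = Kernel.const _ (P.map (signMap s)) := by
    intro f
    by_cases h : ∃ s, f.1 = linFun (signMap s u)
    · obtain ⟨s, hs⟩ := h
      have hQ := hP.map_signMap s
      have := hQ.isProb
      refine ⟨Kernel.const _ (P.map (signMap s)), inferInstance, fun x => ?_, fun s' hs' => ?_⟩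
      · simp only [Kernel.const_apply]
        refine ⟨signMap s u, ?_, hQ.integrable, hQ.mean, hQ.dir, hQ.norm⟩
        rw [hs]
        exact mem_subgradients_linFun x
      · rw [hP.map_signMap_congr (linFun_injective (hs.symm.trans hs'))]
    -- Outside the hard family the answers are noiseless, so both moments vanish; measurability of
    -- `v` makes the answer a kernel.
    · obtain ⟨v, hv, hsub⟩ := exists_measurable_subgradient f.2
      refine ⟨Kernel.deterministic v hv, inferInstance, fun x => ⟨v x, hsub x, ?_, ?_, ?_, ?_⟩,
        fun s hs => absurd ⟨s, hs⟩ h⟩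
      · simp [Kernel.deterministic_apply, integrable_dirac]
      · simp [Kernel.deterministic_apply]
      · simp [Kernel.deterministic_apply, hp.ne']
      · simp [Kernel.deterministic_apply, hp.ne']
  choose κ h1 h2 h3 using hex
  exact ⟨⟨κ, h1, h2⟩, fun s hs => h3 _ s rfl⟩

end IsMask

/-! ### From unseen coordinates to the minimax error -/

lemma gradLaw_const {d T : ℕ} (A : Algorithm d T) (Q : Measure (Vec d)) [IsProbabilityMeasure Q] :
    ∀ (t : ℕ) (h : t ≤ T), gradLaw A (Kernel.const _ Q) t h = Measure.pi fun _ => Q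
  | 0, _ => by
    rw [gradLaw, Measure.pi_of_empty]
    congr
  | t + 1, h => by
    have hc : (Kernel.const (Vec d) Q).comap (A.step ⟨t, by omega⟩)
        (A.measurable_step ⟨t, by omega⟩) = Kernel.const _ Q := rfl
    rw [gradLaw, gradLaw_const A Q t, hc, Measure.compProd_const]
    have h1 := (measurePreserving_piFinSuccAbove (fun _ : Fin (t + 1) => Q) (Fin.last t)).symm
    have h2 := h1.comp Measure.measurePreserving_swap
    rw [← h2.map_eq]
    congr 1
    funext z
    exact (Fin.insertNth_last' z.2 z.1).symm

lemma ofReal_le_errorQuantile {d : ℕ} {F : Vec d → ℝ} {ν : Measure (Vec d)} {δ r : ℝ}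
    (h : ENNReal.ofReal δ < ν {x | r ≤ F x - ⨅ y, F y}) :
    ENNReal.ofReal r ≤ errorQuantile F ν δ := by
  refine le_iInf₂ fun ε hε => ?_
  by_contra! hlt
  refine absurd (hε.trans_lt h) (not_lt.2 (measure_mono fun x hx => ?_))
  have h1 : (ε : ℝ) < r := by
    rw [← ENNReal.ofReal_coe_nnreal] at hlt
    exact ENNReal.ofReal_lt_ofReal_iff_of_nonneg ε.2 |>.1 hlt
  exact h1.trans_le hx

namespace IsMask

variable {d T : ℕ} {P : Measure (Vec d)} {u : Vec d} {D G μ p σs σl δ r : ℝ}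

open Classical in
/-- If `ω` has zero coordinates at all times on a set `U`, then for every choice of the signs `s`,
the estimator has a large error at `s` or at `s` flipped on `U`. -/
lemma error_or_error_flip (est : (Fin T → Vec d) → Vec d) (ω : Fin T → Vec d)
    (hr : r ≤ ∑ i with ∀ t, ω t i = 0, u i ^ 2) (s : Fin d → ℤˣ) :
    let B : (Fin d → ℤˣ) → Prop := fun s => r ≤ ‖est (fun t => signMap s (ω t)) + signMap s u‖ ^ 2
    B s ∨ B (s * fun i => if ∀ t, ω t i = 0 then -1 else 1) := by
  intro B
  set h : Fin d → ℤˣ := fun i => if ∀ t, ω t i = 0 then -1 else 1 with hh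
  -- The flipped coordinates are zero in every observation, so the estimator sees the same data
  -- under both sign patterns.
  have hobs : (fun t => signMap (s * h) (ω t)) = fun t => signMap s (ω t) := by
    funext t
    ext i
    by_cases hi : ∀ t, ω t i = 0
    · simp [hi t]
    · simp [hh, hi]
  by_contra! hcon
  obtain ⟨h1, h2⟩ := hcon
  simp only [B, not_le, hobs] at h1 h2
  set x := est fun t => signMap s (ω t)
  have h3 : ‖signMap s u - signMap (s * h) u‖ ^ 2 = 4 * ∑ i with ∀ t, ω t i = 0, u i ^ 2 := by
    rw [EuclideanSpace.real_norm_sq_eq, Finset.mul_sum, Finset.sum_filter]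
    refine Finset.sum_congr rfl fun i _ => ?_
    by_cases hi : ∀ t, ω t i = 0
    · rcases Int.units_eq_one_or (s i) with h | h <;> simp [hh, hi, h] <;> ring
    · simp [hh, hi]
  -- The two squared errors sum to at least half the squared distance of the targets, that is, to at
  -- least `2 * r`.
  have h4 := parallelogram_law_with_norm ℝ (x + signMap s u) (x + signMap (s * h) u)
  rw [add_sub_add_left_eq_sub] at h4
  nlinarith [norm_nonneg (x + signMap s u + (x + signMap (s * h) u))]

-- For each `ω` with enough unseen mass, at least half of all sign patterns are bad, since every `s`
-- or its flip is. Integrating over `ω` bounds the average of `Q (B s)` below by `Q S / 2 > δ`.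
open Classical in
lemma exists_large_error [IsProbabilityMeasure P] {est : (Fin T → Vec d) → Vec d}
    (hest : Measurable est)
    (hr : ENNReal.ofReal (2 * δ) < Measure.pi (fun _ : Fin T => P)
      {ω | r ≤ ∑ i with ∀ t, ω t i = 0, u i ^ 2}) :
    ∃ s : Fin d → ℤˣ, ENNReal.ofReal δ < Measure.pi (fun _ : Fin T => P)
      {ω | r ≤ ‖est (fun t => signMap s (ω t)) + signMap s u‖ ^ 2} := by
  by_contra! hcon
  set Q := Measure.pi (fun _ : Fin T => P)
  set B : (Fin d → ℤˣ) → Set (Fin T → Vec d) :=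
    fun s => {ω | r ≤ ‖est (fun t => signMap s (ω t)) + signMap s u‖ ^ 2} with hB
  set S : Set (Fin T → Vec d) := {ω | r ≤ ∑ i with ∀ t, ω t i = 0, u i ^ 2}
  have hBm : ∀ s, MeasurableSet (B s) := fun s => by
    refine measurableSet_le measurable_const ?_
    refine (((hest.comp (measurable_pi_lambda _ fun t => ?_)).add_const _).norm).pow_const 2
    exact (measurable_signMap s).comp (measurable_pi_apply t)
  have hN : (Fintype.card (Fin d → ℤˣ) : ℝ≥0∞) ≠ 0 := by simp
  have hpt : ∀ ω ∈ S, (Fintype.card (Fin d → ℤˣ) : ℝ≥0∞)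
      ≤ 2 * ∑ s, (B s).indicator (fun _ => 1) ω := by
    intro ω hω
    -- The flip depends on `ω` but not on `s`, so multiplication by it permutes the sign patterns
    -- and preserves the sum.
    set h : Fin d → ℤˣ := fun i => if ∀ t, ω t i = 0 then -1 else 1
    have hflip : ∑ s, (B (s * h)).indicator (fun _ => (1 : ℝ≥0∞)) ω
        = ∑ s, (B s).indicator (fun _ => (1 : ℝ≥0∞)) ω :=
      Equiv.sum_comp (Equiv.mulRight h) fun s => (B s).indicator (fun _ => (1 : ℝ≥0∞)) ω
    rw [two_mul]
    nth_rw 2 [← hflip]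
    rw [← Finset.sum_add_distrib, ← Finset.card_univ, Finset.card_eq_sum_ones]
    push_cast
    refine Finset.sum_le_sum fun s _ => ?_
    rcases error_or_error_flip (u := u) est ω hω s with h1 | h1
    · exact le_add_right (by rw [Set.indicator_of_mem (show ω ∈ B s from h1)])
    · exact le_add_left (by rw [Set.indicator_of_mem (show ω ∈ B (s * h) from h1)])
  have h1 : (Fintype.card (Fin d → ℤˣ) : ℝ≥0∞) * Q S ≤ 2 * ∑ s, Q (B s) := by
    have hm : ∀ s, Measurable ((B s).indicator fun _ => (1 : ℝ≥0∞)) := fun s =>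
      measurable_const.indicator (hBm s)
    have hms : Measurable fun ω => ∑ s, (B s).indicator (fun _ => (1 : ℝ≥0∞)) ω :=
      Finset.measurable_sum _ fun s _ => hm s
    calc (Fintype.card (Fin d → ℤˣ) : ℝ≥0∞) * Q S
        ≤ (Fintype.card (Fin d → ℤˣ) : ℝ≥0∞) * Q {ω | (Fintype.card (Fin d → ℤˣ) : ℝ≥0∞)
            ≤ 2 * ∑ s, (B s).indicator (fun _ => 1) ω} := by
          gcongr
          exact hpt
      _ ≤ ∫⁻ ω, 2 * ∑ s, (B s).indicator (fun _ => 1) ω ∂Q :=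
          mul_meas_ge_le_lintegral (hms.const_mul 2) _
      _ = 2 * ∑ s, Q (B s) := by
          rw [lintegral_const_mul _ hms, lintegral_finsetSum _ fun s _ => hm s]
          simp [lintegral_indicator_const (hBm _)]
  have h2 : (Fintype.card (Fin d → ℤˣ) : ℝ≥0∞) * Q S
      ≤ (Fintype.card (Fin d → ℤˣ) : ℝ≥0∞) * ENNReal.ofReal (2 * δ) := by
    refine h1.trans ((mul_le_mul_right (Finset.sum_le_sum fun s _ => hcon s) 2).trans ?_)
    rw [Finset.sum_const, Finset.card_univ, nsmul_eq_mul, ENNReal.ofReal_mul two_pos.le,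
      ENNReal.ofReal_ofNat]
    exact le_of_eq (by ring)
  exact absurd ((ENNReal.mul_le_mul_iff_right hN (ENNReal.natCast_ne_top _)).1 h2) (not_le.2 hr)

-- The reduction used for every rate. The estimator is `μ` times the output, and the law of the
-- observations is the image under `s` of i.i.d. draws from `P`. The conditions on `‖u‖` are the
-- Lipschitz bound and the bound `‖u‖ / μ ≤ D` on the minimizer.
open Classical in
theorem le_minimaxStr (hP : IsMask P u p σs σl) (hp : 0 < p) (hμ : 0 < μ) (hG : ‖u‖ ≤ G)
    (hD : ‖u‖ ≤ μ * D)
    (hr : ENNReal.ofReal (2 * δ) < Measure.pi (fun _ : Fin T => P)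
      {ω | r ≤ ∑ i with ∀ t, ω t i = 0, u i ^ 2}) :
    ENNReal.ofReal (r / (2 * μ)) ≤ minimaxStr d T D G μ p σs σl δ := by
  have := hP.isProb
  obtain ⟨g, hg⟩ := hP.exists_oracle (G := G) hp
  refine le_iSup_of_le g (le_iInf fun A => ?_)
  have hA := A.measurable_step (Fin.last T)
  obtain ⟨s, hs⟩ := exists_large_error (P := P)
    (est := fun ω => μ • A.step (Fin.last T) ω) (hA.const_smul μ) hr
  have hsG : ‖signMap s u‖ ≤ G := by rwa [LinearIsometry.norm_map]
  have hsD : ‖signMap s u‖ ≤ μ * D := by rwa [LinearIsometry.norm_map]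
  have hmem := linFun_mem_lipConvex hsG
  refine le_iSup₂_of_le ⟨_, hmem⟩ (linFun_add_reg_mem_strClass hμ hsG hsD)
    (ofReal_le_errorQuantile (hs.trans_le (le_of_eq ?_)))
  have hms := measurable_signMap s
  have hPs : IsProbabilityMeasure (P.map (signMap s)) :=
    Measure.isProbabilityMeasure_map hms.aemeasurable
  simp only [linFun_gap hμ]
  have hset : MeasurableSet {x : Vec d | r / (2 * μ) ≤ ‖μ • x + signMap s u‖ ^ 2 / (2 * μ)} :=
    measurableSet_le measurable_const (by fun_prop)
  rw [outputLaw, hg s hmem, gradLaw_const, Measure.map_apply hA hset,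
    ← Measure.pi_map_pi (fun _ => hms.aemeasurable), Measure.map_apply (by fun_prop) (hA hset)]
  congr 1
  ext ω
  simp only [Set.mem_ofPred_eq, Set.mem_preimage]
  rw [div_le_div_iff_of_pos_right (by positivity)]
  rfl

end IsMask

/-! ### Two criteria for a large unseen mass -/

namespace IsMask

variable {d T : ℕ} {P : Measure (Vec d)} {u : Vec d} {D G μ p σs σl δ : ℝ}

-- If every draw is zero, the whole mass `‖u‖ ^ 2` is unseen.
open Classical in
lemma le_minimaxStr_of_singleton_zero (hP : IsMask P u p σs σl) (hp : 0 < p) (hμ : 0 < μ)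
    (hG : ‖u‖ ≤ G) (hD : ‖u‖ ≤ μ * D) (h0 : ENNReal.ofReal (2 * δ) < P {0} ^ T) :
    ENNReal.ofReal (‖u‖ ^ 2 / (2 * μ)) ≤ minimaxStr d T D G μ p σs σl δ := by
  have := hP.isProb
  refine hP.le_minimaxStr hp hμ hG hD (h0.trans_le ?_)
  have h1 := Measure.pi_pi (fun _ : Fin T => P) (fun _ => {0})
  rw [Finset.prod_const, Finset.card_univ, Fintype.card_fin] at h1
  rw [← h1]
  refine measure_mono fun ω hω => ?_
  have h2 : ∀ i, ∀ t, ω t i = 0 := fun i t => by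
    have h3 : ω t = 0 := hω t trivial
    simp [h3]
  simp [h2, EuclideanSpace.real_norm_sq_eq]

-- By a union bound over the rounds, a coordinate is seen with probability at most `1/4`. The
-- expected seen mass is thus at most `‖u‖ ^ 2 / 4`, and Markov's inequality applies.
open Classical in
lemma half_le_prob_unseen [IsProbabilityMeasure P] (hu : u ≠ 0) (hT : 1 ≤ T)
    (h0 : ∀ i, P {y | y i ≠ 0} ≤ ENNReal.ofReal (1 / (4 * T))) :
    ENNReal.ofReal (1 / 2) ≤ Measure.pi (fun _ : Fin T => P)
      {ω | ‖u‖ ^ 2 / 2 ≤ ∑ i with ∀ t, ω t i = 0, u i ^ 2} := by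
  set Q := Measure.pi (fun _ : Fin T => P) with hQ
  set S := {ω : Fin T → Vec d | ‖u‖ ^ 2 / 2 ≤ ∑ i with ∀ t, ω t i = 0, u i ^ 2} with hS
  have hupos : 0 < ‖u‖ ^ 2 := by positivity
  have hTpos : (0 : ℝ) < T := by exact_mod_cast hT
  have hset : ∀ (t : Fin T) i, MeasurableSet {ω : Fin T → Vec d | ω t i ≠ 0} := fun t i =>
    (measurableSet_singleton (0 : ℝ)).compl.preimage (by fun_prop)
  -- `X` counts a seen coordinate once for each round that reveals it, so it dominates the seen mass
  -- and its integral is explicit.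
  set X : (Fin T → Vec d) → ℝ≥0∞ := fun ω =>
    ∑ i, ∑ t : Fin T, {ω : Fin T → Vec d | ω t i ≠ 0}.indicator
      (fun _ => ENNReal.ofReal (u i ^ 2)) ω with hX
  have hXm : Measurable X := Finset.measurable_sum _ fun i _ => Finset.measurable_sum _ fun t _ =>
    measurable_const.indicator (hset t i)
  have hint : ∫⁻ ω, X ω ∂Q ≤ ENNReal.ofReal (‖u‖ ^ 2 / 4) := by
    have h1 : ∀ (t : Fin T) i, Q {ω | ω t i ≠ 0} ≤ ENNReal.ofReal (1 / (4 * T)) := fun t i => by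
      have h2 := (measurePreserving_eval (fun _ : Fin T => P) t).measure_preimage
        (s := {y | y i ≠ 0})
        ((measurableSet_singleton (0 : ℝ)).compl.preimage (by fun_prop)).nullMeasurableSet
      exact (le_of_eq h2).trans (h0 i)
    calc ∫⁻ ω, X ω ∂Q
        = ∑ i, ∑ t : Fin T, ENNReal.ofReal (u i ^ 2) * Q {ω | ω t i ≠ 0} := by
          rw [lintegral_finsetSum _ fun i _ => Finset.measurable_sum _ fun t _ =>
            measurable_const.indicator (hset t i)]
          refine Finset.sum_congr rfl fun i _ => ?_
          rw [lintegral_finsetSum _ fun t _ => measurable_const.indicator (hset t i)]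
          exact Finset.sum_congr rfl fun t _ => lintegral_indicator_const (hset t i) _
      _ ≤ ∑ i, ∑ t : Fin T, ENNReal.ofReal (u i ^ 2) * ENNReal.ofReal (1 / (4 * T)) := by
          gcongr
          exact h1 _ _
      _ = ENNReal.ofReal (‖u‖ ^ 2 / 4) := by
          simp_rw [← ENNReal.ofReal_mul (sq_nonneg _)]
          simp only [Finset.sum_const, Finset.card_univ, Fintype.card_fin, nsmul_eq_mul]
          rw [← Finset.mul_sum, ← ENNReal.ofReal_sum_of_nonneg fun i _ => by positivity,
            ← ENNReal.ofReal_natCast, ← ENNReal.ofReal_mul hTpos.le, ← Finset.sum_mul,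
            ← EuclideanSpace.real_norm_sq_eq]
          congr 1
          field_simp
  have hbad : Sᶜ ⊆ {ω | ENNReal.ofReal (‖u‖ ^ 2 / 2) ≤ X ω} := by
    intro ω hω
    have h1 : ∑ i with ∀ t, ω t i = 0, u i ^ 2 < ‖u‖ ^ 2 / 2 := not_le.1 hω
    have h2 := Finset.sum_filter_add_sum_filter_not Finset.univ (fun i => ∀ t, ω t i = 0)
      (fun i => u i ^ 2)
    rw [← EuclideanSpace.real_norm_sq_eq] at h2
    calc ENNReal.ofReal (‖u‖ ^ 2 / 2)
        ≤ ENNReal.ofReal (∑ i with ¬ ∀ t, ω t i = 0, u i ^ 2) :=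
          ENNReal.ofReal_le_ofReal (by linarith)
      _ = ∑ i with ¬ ∀ t, ω t i = 0, ENNReal.ofReal (u i ^ 2) :=
          ENNReal.ofReal_sum_of_nonneg fun i _ => sq_nonneg _
      _ ≤ X ω := by
          rw [Finset.sum_filter]
          refine Finset.sum_le_sum fun i _ => ?_
          split_ifs with h
          · exact zero_le
          · obtain ⟨t, ht⟩ := not_forall.1 h
            refine le_trans (le_of_eq ?_) (Finset.single_le_sum (fun _ _ => zero_le)
              (Finset.mem_univ t))
            rw [Set.indicator_of_mem (show ω ∈ {ω : Fin T → Vec d | ω t i ≠ 0} from ht)]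
  have h3 : ENNReal.ofReal (‖u‖ ^ 2 / 2) * Q Sᶜ ≤ ENNReal.ofReal (‖u‖ ^ 2 / 2) *
      ENNReal.ofReal (1 / 2) := by
    refine ((mul_le_mul_right (measure_mono hbad) _).trans
      (mul_meas_ge_le_lintegral hXm _)).trans (hint.trans (le_of_eq ?_))
    rw [← ENNReal.ofReal_mul (by positivity)]
    congr 1
    ring
  have h4 : Q Sᶜ ≤ ENNReal.ofReal (1 / 2) :=
    (ENNReal.mul_le_mul_iff_right (ENNReal.ofReal_pos.2 (half_pos hupos)).ne'
      ENNReal.ofReal_ne_top).1 h3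
  have h5 : ENNReal.ofReal (1 / 2) + ENNReal.ofReal (1 / 2)
      ≤ Q S + ENNReal.ofReal (1 / 2) := by
    refine le_trans (le_of_eq ?_) ((measure_union_le S Sᶜ).trans (by gcongr))
    rw [Set.union_compl_self, measure_univ, ← ENNReal.ofReal_add (by norm_num) (by norm_num)]
    norm_num
  exact (ENNReal.add_le_add_iff_right ENNReal.ofReal_ne_top).1 h5

lemma le_minimaxStr_of_prob_ne_zero (hP : IsMask P u p σs σl) (hp : 0 < p) (hμ : 0 < μ)
    (hG : ‖u‖ ≤ G) (hD : ‖u‖ ≤ μ * D) (hT : 1 ≤ T) (hδ : δ < 1 / 10)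
    (h0 : ∀ i, P {y | y i ≠ 0} ≤ ENNReal.ofReal (1 / (4 * T))) :
    ENNReal.ofReal (‖u‖ ^ 2 / 2 / (2 * μ)) ≤ minimaxStr d T D G μ p σs σl δ := by
  by_cases hu : u = 0
  · simp [hu]
  have := hP.isProb
  refine hP.le_minimaxStr hp hμ hG hD (lt_of_lt_of_le ?_ (half_le_prob_unseen hu hT h0))
  exact (ENNReal.ofReal_lt_ofReal_iff (by norm_num)).2 (by linarith)

end IsMask

/-! ### Sparse masks: at most one coordinate revealed per round -/

/-- The distribution that reveals each coordinate in `M` with probability `ρ`, and at most one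
coordinate at a time. -/
def sparseMask {d : ℕ} (M : Finset (Fin d)) (ρ b : ℝ) : Measure (Vec d) :=
  ENNReal.ofReal (1 - M.card * ρ) • Measure.dirac 0 +
    ∑ i ∈ M, ENNReal.ofReal ρ • Measure.dirac (EuclideanSpace.single i (b / ρ))

/-- The vector with the coordinates `b` on `M` and `0` elsewhere. -/
def flatVec {d : ℕ} (M : Finset (Fin d)) (b : ℝ) : Vec d :=
  WithLp.toLp 2 fun i => if i ∈ M then b else 0

section sparseMask

variable {d : ℕ} {M : Finset (Fin d)} {ρ b p σs σl : ℝ}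

lemma flatVec_apply (i : Fin d) : flatVec M b i = if i ∈ M then b else 0 := rfl

lemma norm_flatVec_sq : ‖flatVec M b‖ ^ 2 = M.card * b ^ 2 := by
  simp [EuclideanSpace.real_norm_sq_eq, flatVec_apply]

lemma norm_flatVec (hb : 0 ≤ b) : ‖flatVec M b‖ = √M.card * b := by
  rw [← Real.sqrt_sq (norm_nonneg _), norm_flatVec_sq, Real.sqrt_mul (by positivity),
    Real.sqrt_sq hb]

lemma flatVec_eq_sum : flatVec M b = ∑ i ∈ M, EuclideanSpace.single i b := by
  ext j
  simp [flatVec_apply, Finset.sum_apply, Pi.single_apply]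

lemma lintegral_sparseMask (g : Vec d → ℝ≥0∞) :
    ∫⁻ y, g y ∂(sparseMask M ρ b) = ENNReal.ofReal (1 - M.card * ρ) * g 0 +
      ∑ i ∈ M, ENNReal.ofReal ρ * g (EuclideanSpace.single i (b / ρ)) := by
  simp [sparseMask, lintegral_add_measure, lintegral_finsetSum_measure, lintegral_smul_measure,
    lintegral_dirac]

lemma lintegral_sparseMask_ofReal (hρ : 0 ≤ ρ) (hM : M.card * ρ ≤ 1) {g : Vec d → ℝ}
    (hg : ∀ y, 0 ≤ g y) :
    ∫⁻ y, ENNReal.ofReal (g y) ∂(sparseMask M ρ b) = ENNReal.ofReal ((1 - M.card * ρ) * g 0 +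
      ∑ i ∈ M, ρ * g (EuclideanSpace.single i (b / ρ))) := by
  rw [lintegral_sparseMask, ENNReal.ofReal_add (mul_nonneg (by linarith) (hg _))
    (Finset.sum_nonneg fun i _ => mul_nonneg hρ (hg _)), ENNReal.ofReal_mul (by linarith),
    ENNReal.ofReal_sum_of_nonneg fun i _ => mul_nonneg hρ (hg _)]
  simp only [ENNReal.ofReal_mul hρ]

lemma isMask_sparseMask (hρ : 0 < ρ) (hM : M.card * ρ ≤ 1)
    (hdir : ∀ e : Vec d, ‖e‖ = 1 → (1 - M.card * ρ) * |inner ℝ e (flatVec M b)| ^ p +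
      ∑ i ∈ M, ρ * |inner ℝ e (EuclideanSpace.single i (b / ρ) - flatVec M b)| ^ p ≤ σs ^ p)
    (hnorm : (1 - M.card * ρ) * ‖flatVec M b‖ ^ p +
      ∑ i ∈ M, ρ * ‖EuclideanSpace.single i (b / ρ) - flatVec M b‖ ^ p ≤ σl ^ p) :
    IsMask (sparseMask M ρ b) (flatVec M b) p σs σl where
  isProb := ⟨by
    rw [← lintegral_one]
    simp_rw [← ENNReal.ofReal_one]
    rw [lintegral_sparseMask_ofReal hρ.le hM fun _ => zero_le_one]
    simp⟩
  integrable := by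
    refine Integrable.add_measure ((integrable_dirac (by simp)).smul_measure (by simp)) ?_
    rw [integrable_finsetSum_measure]
    exact fun i _ => (integrable_dirac (by simp)).smul_measure (by simp)
  mean := by
    rw [sparseMask, integral_add_measure, integral_finsetSum_measure]
    · simp only [integral_smul_measure, integral_dirac, smul_zero, zero_add, flatVec_eq_sum]
      refine Finset.sum_congr rfl fun i _ => ?_
      rw [ENNReal.toReal_ofReal hρ.le]
      ext j
      by_cases h : j = i <;> simp [h]
      field_simp
    · exact fun i _ => (integrable_dirac (by simp)).smul_measure (by simp)
    · exact (integrable_dirac (by simp)).smul_measure (by simp)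
    · rw [integrable_finsetSum_measure]
      exact fun i _ => (integrable_dirac (by simp)).smul_measure (by simp)
  dir e he := by
    rw [lintegral_sparseMask_ofReal hρ.le hM fun _ => by positivity]
    refine ENNReal.ofReal_le_ofReal (le_trans (le_of_eq ?_) (hdir e he))
    simp
  norm := by
    rw [lintegral_sparseMask_ofReal hρ.le hM fun _ => by positivity]
    refine ENNReal.ofReal_le_ofReal (le_trans (le_of_eq ?_) hnorm)
    simp
  support := by
    have hset : MeasurableSet {y : Vec d | ∀ i, flatVec M b i = 0 → y i = 0} := by
      simp only [Set.ofPred_forall]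
      exact MeasurableSet.iInter fun i => MeasurableSet.iInter fun _ =>
        (measurableSet_singleton (0 : ℝ)).preimage (by fun_prop)
    rw [sparseMask, ae_add_measure_iff]
    refine ⟨Measure.ae_smul_measure ((ae_dirac_iff hset).2 (by simp)) _, ?_⟩
    rw [ae_finsetSum_measure_iff]
    refine fun i hi => Measure.ae_smul_measure ((ae_dirac_iff hset).2 fun j hj => ?_) _
    rw [flatVec_apply] at hj
    by_cases h : j = i
    · subst h
      simp [hi] at hj
      simp [hj]
    · simp [h]

lemma sparseMask_ne_zero (i : Fin d) : sparseMask M ρ b {y | y i ≠ 0} ≤ ENNReal.ofReal ρ := by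
  have hset : MeasurableSet {y : Vec d | y i ≠ 0} :=
    (measurableSet_singleton (0 : ℝ)).compl.preimage (by fun_prop)
  rw [← lintegral_indicator_one hset, lintegral_sparseMask]
  calc _ ≤ ∑ j ∈ M, if j = i then ENNReal.ofReal ρ else 0 := by
        simp only [Set.indicator_apply, Set.mem_ofPred_eq, PiLp.zero_apply, ne_eq, not_true,
          if_false, mul_zero, zero_add]
        refine Finset.sum_le_sum fun j _ => ?_
        by_cases h : j = i
        · simp only [h, if_true]
          split_ifs <;> simp
        · simp [h, Ne.symm h]
    _ ≤ ENNReal.ofReal ρ := by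
        rw [Finset.sum_ite_eq']
        split_ifs <;> simp

lemma le_sparseMask_zero : ENNReal.ofReal (1 - M.card * ρ) ≤ sparseMask M ρ b {0} := by
  rw [← lintegral_indicator_one (measurableSet_singleton 0), lintegral_sparseMask]
  exact le_add_right (by simp)

end sparseMask

section sparseMask

variable {d : ℕ} {M : Finset (Fin d)} {ρ b p σs σl : ℝ}

lemma add_rpow_le_two_rpow (hp : 1 ≤ p) {x y : ℝ} (hx : 0 ≤ x) (hy : 0 ≤ y) :
    (x + y) ^ p ≤ 2 ^ (p - 1) * (x ^ p + y ^ p) := by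
  have := NNReal.rpow_add_le_mul_rpow_add_rpow ⟨x, hx⟩ ⟨y, hy⟩ hp
  exact_mod_cast this

/-- Centering costs only the factor `2 ^ (p - 1)`. It is stated for a general `N` to serve both
`|⟨e, ·⟩|` and the norm. -/
lemma sparseMask_moment_le (hp : 1 ≤ p) (hρ : 0 ≤ ρ) (hM : M.card * ρ ≤ 1) {N : Vec d → ℝ}
    (hN : ∀ y, 0 ≤ N y) (hsub : ∀ y z, N (y - z) ≤ N y + N z) (u : Vec d) (w : Fin d → Vec d) :
    (1 - M.card * ρ) * N u ^ p + ∑ i ∈ M, ρ * N (w i - u) ^ p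
      ≤ 2 ^ (p - 1) * (N u ^ p + ∑ i ∈ M, ρ * N (w i) ^ p) := by
  have h2 : (1 : ℝ) ≤ 2 ^ (p - 1) := Real.one_le_rpow one_le_two (by linarith)
  have hNu : 0 ≤ N u ^ p := Real.rpow_nonneg (hN u) p
  have h1 : ∑ i ∈ M, ρ * N (w i - u) ^ p
      ≤ ∑ i ∈ M, (2 ^ (p - 1) * (ρ * N (w i) ^ p) + 2 ^ (p - 1) * ρ * N u ^ p) := by
    refine Finset.sum_le_sum fun i _ => ?_
    have h3 := (Real.rpow_le_rpow (hN _) (hsub (w i) u) (by linarith)).trans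
      (add_rpow_le_two_rpow hp (hN (w i)) (hN u))
    nlinarith [mul_le_mul_of_nonneg_left h3 hρ]
  rw [Finset.sum_add_distrib, Finset.sum_const, ← Finset.mul_sum (f := fun i => ρ * N (w i) ^ p),
    nsmul_eq_mul] at h1
  have h4 : (1 - M.card * ρ) * N u ^ p ≤ 2 ^ (p - 1) * ((1 - M.card * ρ) * N u ^ p) :=
    le_mul_of_one_le_left (mul_nonneg (by linarith) hNu) h2
  linarith

/-- Power mean inequality with exponent `2 / p`, combined with `∑ (e i) ^ 2 ≤ 1`. -/
lemma sum_abs_rpow_le {e : Vec d} (he : ‖e‖ = 1) (hp : 0 < p) (hp2 : p ≤ 2) :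
    ∑ i ∈ M, |e i| ^ p ≤ (M.card : ℝ) ^ (1 - p / 2) := by
  have he2 : ∑ i ∈ M, (e i) ^ 2 ≤ 1 := by
    have := EuclideanSpace.real_norm_sq_eq e
    rw [he, one_pow] at this
    rw [this]
    exact Finset.sum_le_univ_sum_of_nonneg fun i => sq_nonneg _
  have hsum : 0 ≤ ∑ i ∈ M, |e i| ^ p := Finset.sum_nonneg fun i _ => by positivity
  have hq : 1 ≤ 2 / p := by rwa [one_le_div hp]
  have h1 := Real.rpow_sum_le_const_mul_sum_rpow_of_nonneg M (f := fun i => |e i| ^ p) hq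
    fun i _ => by positivity
  have h2 : ∑ i ∈ M, (|e i| ^ p) ^ (2 / p) = ∑ i ∈ M, (e i) ^ 2 := by
    refine Finset.sum_congr rfl fun i _ => ?_
    rw [← Real.rpow_mul (abs_nonneg _), mul_div_cancel₀ _ hp.ne', Real.rpow_two, sq_abs]
  rw [h2] at h1
  have h3 : (∑ i ∈ M, |e i| ^ p) ^ (2 / p) ≤ (M.card : ℝ) ^ (2 / p - 1) :=
    h1.trans (mul_le_of_le_one_right (by positivity) he2)
  have h4 := Real.rpow_le_rpow (by positivity) h3 (by positivity : 0 ≤ p / 2)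
  rw [← Real.rpow_mul hsum, ← Real.rpow_mul (by positivity)] at h4
  convert h4 using 1
  · rw [div_mul_div_cancel₀ hp.ne', div_self two_ne_zero, Real.rpow_one]
  · congr 1
    field_simp

/-- The spread mask: all coordinates in `M` have the same weight. -/
lemma isMask_sparseMask_spread (hp : 1 ≤ p) (hp2 : p ≤ 2) (hρ : 0 < ρ) (hM0 : M.Nonempty)
    (hM : M.card * ρ ≤ 1) (hb : 0 ≤ b) (hσs : 0 ≤ σs) (hσ : √M.card * σs ≤ σl)
    (hbσ : b ^ p * ρ ^ (1 - p) * (M.card : ℝ) ^ (1 - p / 2) ≤ (σs / 2) ^ p) :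
    IsMask (sparseMask M ρ b) (flatVec M b) p σs σl := by
  have hm : (0 : ℝ) < M.card := by exact_mod_cast hM0.card_pos
  have hp0 : 0 < p := by linarith
  set X := b ^ p * ρ ^ (1 - p) * (M.card : ℝ) ^ (1 - p / 2) with hX
  have hX0 : 0 ≤ X := by positivity
  have hsqrt : √(M.card : ℝ) ^ p = (M.card : ℝ) ^ (p / 2) := by
    rw [Real.sqrt_eq_rpow, ← Real.rpow_mul hm.le]
    congr 1; ring
  have hu : ‖flatVec M b‖ ^ p ≤ X := by
    rw [norm_flatVec hb, Real.mul_rpow (by positivity) hb, hsqrt]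
    -- This amounts to `(M.card * ρ) ^ (p - 1) ≤ 1`: the mean contributes no more than the revealed
    -- coordinates.
    have h1 : (M.card : ℝ) ^ (p / 2) ≤ ρ ^ (1 - p) * (M.card : ℝ) ^ (1 - p / 2) := by
      have h2 : (M.card : ℝ) ^ (p / 2) = (M.card : ℝ) ^ (p - 1) * (M.card : ℝ) ^ (1 - p / 2) := by
        rw [← Real.rpow_add hm]; congr 1; ring
      rw [h2]
      gcongr
      have h3 := Real.rpow_le_one (by positivity) hM (by linarith : 0 ≤ p - 1)
      rw [Real.mul_rpow hm.le hρ.le] at h3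
      rw [show 1 - p = -(p - 1) by ring, Real.rpow_neg hρ.le]
      rwa [← one_div, le_div_iff₀ (by positivity)]
    calc _ = b ^ p * (M.card : ℝ) ^ (p / 2) := mul_comm _ _
      _ ≤ b ^ p * (ρ ^ (1 - p) * (M.card : ℝ) ^ (1 - p / 2)) := by gcongr
      _ = X := by rw [hX]; ring
  have hρp : ρ * (b / ρ) ^ p = b ^ p * ρ ^ (1 - p) := by
    rw [Real.div_rpow hb hρ.le, Real.rpow_sub hρ, Real.rpow_one]; ring
  -- The `2` in `σs / 2` absorbs the centering factor and the sum of two terms of size at most `X`.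
  have htwo : (2 : ℝ) ^ (p - 1) * (2 * (σs / 2) ^ p) = σs ^ p := by
    rw [Real.div_rpow hσs two_pos.le, Real.rpow_sub two_pos, Real.rpow_one]
    field_simp
  refine isMask_sparseMask hρ hM (fun e he => ?_) ?_
  · refine (sparseMask_moment_le hp hρ.le hM (N := fun y => |inner ℝ e y|) (fun y => abs_nonneg _)
      (fun y z => by rw [inner_sub_right]; exact abs_sub _ _) _ _).trans ?_
    have h1 : |inner ℝ e (flatVec M b)| ^ p ≤ X := by
      refine le_trans (Real.rpow_le_rpow (abs_nonneg _) ?_ hp0.le) hu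
      simpa [he] using abs_real_inner_le_norm e (flatVec M b)
    have h2 : ∑ i ∈ M, ρ * |inner ℝ e (EuclideanSpace.single i (b / ρ))| ^ p ≤ X := by
      calc _ = ∑ i ∈ M, (b ^ p * ρ ^ (1 - p)) * |e i| ^ p := by
            refine Finset.sum_congr rfl fun i _ => ?_
            rw [EuclideanSpace.inner_single_right]
            simp only [conj_trivial]
            rw [abs_mul, Real.mul_rpow (abs_nonneg _) (abs_nonneg _),
              abs_of_nonneg (by positivity : 0 ≤ b / ρ), ← hρp]
            ring
        _ ≤ X := by
            rw [← Finset.mul_sum]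
            exact mul_le_mul_of_nonneg_left (sum_abs_rpow_le he hp0 hp2) (by positivity)
    rw [← htwo]
    gcongr
    linarith
  · refine (sparseMask_moment_le hp hρ.le hM (N := fun y => ‖y‖) (fun y => norm_nonneg _)
      (fun y z => norm_sub_le _ _) _ _).trans ?_
    have h1 : (1 : ℝ) ≤ (M.card : ℝ) ^ (p / 2) :=
      Real.one_le_rpow (by exact_mod_cast hM0.card_pos) (by positivity)
    have h2 : ∑ i ∈ M, ρ * ‖(EuclideanSpace.single i (b / ρ) : Vec d)‖ ^ p
        = (M.card : ℝ) ^ (p / 2) * X := by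
      simp only [PiLp.norm_single, Real.norm_eq_abs,
        abs_of_nonneg (by positivity : 0 ≤ b / ρ), hρp, Finset.sum_const, nsmul_eq_mul]
      have h3 : (M.card : ℝ) = (M.card : ℝ) ^ (p / 2) * (M.card : ℝ) ^ (1 - p / 2) := by
        rw [← Real.rpow_add hm, add_sub_cancel, Real.rpow_one]
      rw [hX]
      conv_lhs => rw [h3]
      ring
    rw [h2]
    calc _ ≤ 2 ^ (p - 1) * ((M.card : ℝ) ^ (p / 2) * X + (M.card : ℝ) ^ (p / 2) * X) := by
          gcongr
          nlinarith
      _ ≤ 2 ^ (p - 1) * ((M.card : ℝ) ^ (p / 2) * (σs / 2) ^ p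
            + (M.card : ℝ) ^ (p / 2) * (σs / 2) ^ p) := by gcongr
      _ = (√M.card * σs) ^ p := by
          rw [Real.mul_rpow (by positivity) hσs, hsqrt, ← htwo]; ring
      _ ≤ σl ^ p := by gcongr

/-- The mask on one coordinate, with sharp moment bounds. -/
lemma isMask_sparseMask_single (hp : 0 ≤ p) (hρ : 0 < ρ) (hρ1 : ρ ≤ 1) (hb : 0 ≤ b) (i : Fin d)
    (hσs : 0 ≤ σs) (hσ : σs ≤ σl)
    (hbσ : b ^ p * ((1 - ρ) + ρ ^ (1 - p) * (1 - ρ) ^ p) ≤ σs ^ p) :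
    IsMask (sparseMask {i} ρ b) (flatVec {i} b) p σs σl := by
  have hu : ‖flatVec {i} b‖ = b := by simp [norm_flatVec hb]
  have hw : ‖EuclideanSpace.single i (b / ρ) - flatVec {i} b‖ = b * (1 - ρ) / ρ := by
    have h1 : (EuclideanSpace.single i (b / ρ) : Vec d) - flatVec {i} b
        = EuclideanSpace.single i (b * (1 - ρ) / ρ) := by
      ext j
      by_cases h : j = i
      · simp [h, flatVec_apply]; field_simp
      · simp [h, flatVec_apply]
    rw [h1, PiLp.norm_single, Real.norm_eq_abs, abs_of_nonneg]
    have : 0 ≤ 1 - ρ := by linarith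
    positivity
  have hsum : (1 - ρ) * b ^ p + ρ * (b * (1 - ρ) / ρ) ^ p ≤ σs ^ p := by
    refine le_trans (le_of_eq ?_) hbσ
    rw [Real.div_rpow (mul_nonneg hb (by linarith)) hρ.le, Real.mul_rpow hb (by linarith),
      Real.rpow_sub hρ, Real.rpow_one]
    ring
  refine isMask_sparseMask hρ (by simpa using hρ1) (fun e he => ?_) ?_
  · refine le_trans ?_ hsum
    have hin : ∀ y : Vec d, |inner ℝ e y| ≤ ‖y‖ := fun y => by
      simpa [he] using abs_real_inner_le_norm e y
    rw [Finset.sum_singleton, Finset.card_singleton, Nat.cast_one, one_mul]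
    have : 0 ≤ 1 - ρ := by linarith
    gcongr
    · exact (hin _).trans hu.le
    · exact (hin _).trans hw.le
  · rw [Finset.sum_singleton, Finset.card_singleton, Nat.cast_one, one_mul, hu, hw]
    exact hsum.trans (by gcongr)

end sparseMask

/-! ### Product masks: coordinates revealed independently -/

/-- The distribution of `(u / ρ)` times a Bernoulli variable with parameter `ρ`. -/
def bernoulliMask (ρ u : ℝ) : Measure ℝ :=
  ENNReal.ofReal (1 - ρ) • Measure.dirac 0 + ENNReal.ofReal ρ • Measure.dirac (u / ρ)

/-- The distribution that reveals the coordinates of `u` independently with probability `ρ`. -/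
def productMask {d : ℕ} (ρ : ℝ) (u : Vec d) : Measure (Vec d) :=
  (Measure.pi fun i => bernoulliMask ρ (u i)).map (WithLp.toLp 2)

section bernoulliMask

variable {ρ u : ℝ}

lemma isProbabilityMeasure_bernoulliMask (hρ : 0 ≤ ρ) (hρ1 : ρ ≤ 1) :
    IsProbabilityMeasure (bernoulliMask ρ u) := ⟨by
  simp only [bernoulliMask, Measure.add_apply, Measure.smul_apply, measure_univ, smul_eq_mul,
    mul_one]
  rw [← ENNReal.ofReal_add (by linarith) hρ]
  simp⟩

lemma integrable_bernoulliMask (f : ℝ → ℝ) : Integrable f (bernoulliMask ρ u) :=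
  ((integrable_dirac (by simp)).smul_measure (by simp)).add_measure
    ((integrable_dirac (by simp)).smul_measure (by simp))

lemma integral_bernoulliMask (hρ : 0 ≤ ρ) (hρ1 : ρ ≤ 1) (f : ℝ → ℝ) :
    ∫ x, f x ∂(bernoulliMask ρ u) = (1 - ρ) * f 0 + ρ * f (u / ρ) := by
  rw [bernoulliMask, integral_add_measure ((integrable_dirac (by simp)).smul_measure (by simp))
    ((integrable_dirac (by simp)).smul_measure (by simp))]
  simp [integral_smul_measure, hρ, sub_nonneg.2 hρ1]

lemma memLp_bernoulliMask {f : ℝ → ℝ} (hf : Measurable f) :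
    MemLp f 2 (bernoulliMask ρ u) :=
  (memLp_two_iff_integrable_sq hf.aestronglyMeasurable).2 (integrable_bernoulliMask _)

lemma variance_bernoulliMask_le (hρ : 0 < ρ) (hρ1 : ρ ≤ 1) (c : ℝ) :
    Var[fun x => c * x; bernoulliMask ρ u] ≤ c ^ 2 * (u ^ 2 / ρ) := by
  have := isProbabilityMeasure_bernoulliMask (u := u) hρ.le hρ1
  refine (variance_le_expectation_sq (by fun_prop)).trans (le_of_eq ?_)
  simp only [Pi.pow_apply]
  rw [integral_bernoulliMask hρ.le hρ1]
  field_simp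
  ring

lemma bernoulliMask_ne_zero : bernoulliMask ρ u {x | x ≠ 0} ≤ ENNReal.ofReal ρ := by
  have hset : MeasurableSet {x : ℝ | x ≠ 0} := (measurableSet_singleton (0 : ℝ)).compl
  simp only [bernoulliMask, Measure.add_apply, Measure.smul_apply, smul_eq_mul,
    Measure.dirac_apply' _ hset]
  simp only [Set.indicator_apply, Set.mem_ofPred_eq, ne_eq, not_true, if_false, mul_zero, zero_add]
  split_ifs <;> simp

end bernoulliMask

/-- Concavity of the power `p / 2`: `X ^ p` lies below its tangent line in `X ^ 2` at `X = σ`, and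
integrating the tangent line gives the bound. -/
lemma lintegral_rpow_le_of_integral_sq_le {Ω : Type*} [MeasurableSpace Ω] {P : Measure Ω}
    [IsProbabilityMeasure P] {X : Ω → ℝ} {p σ : ℝ} (hX : ∀ ω, 0 ≤ X ω) (hσ : 0 < σ) (hp : 0 ≤ p)
    (hp2 : p ≤ 2) (hi : Integrable (fun ω => X ω ^ 2) P) (h : ∫ ω, X ω ^ 2 ∂P ≤ σ ^ 2) :
    ∫⁻ ω, ENNReal.ofReal (X ω ^ p) ∂P ≤ ENNReal.ofReal (σ ^ p) := by
  set A := σ ^ p * (1 - p / 2)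
  set B := σ ^ p * (p / 2) / σ ^ 2
  have hpt : ∀ ω, X ω ^ p ≤ A + B * X ω ^ 2 := by
    intro ω
    have h0 : 0 ≤ X ω ^ 2 / σ ^ 2 := by positivity
    have h1 := rpow_one_add_le_one_add_mul_self (s := X ω ^ 2 / σ ^ 2 - 1) (by linarith)
      (by linarith : 0 ≤ p / 2) (by linarith)
    rw [add_sub_cancel, ← div_pow, ← Real.rpow_two, ← Real.rpow_mul (div_nonneg (hX ω) hσ.le),
      mul_div_cancel₀ _ two_ne_zero, Real.div_rpow (hX ω) hσ.le, div_le_iff₀ (by positivity)] at h1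
    refine h1.trans (le_of_eq ?_)
    rw [Real.rpow_two, div_pow]
    ring
  have hint : Integrable (fun ω => A + B * X ω ^ 2) P := (integrable_const A).add (hi.const_mul B)
  refine (lintegral_mono fun ω => ENNReal.ofReal_le_ofReal (hpt ω)).trans ?_
  rw [← ofReal_integral_eq_lintegral_ofReal hint (ae_of_all _ fun ω =>
    (Real.rpow_nonneg (hX ω) p).trans (hpt ω))]
  refine ENNReal.ofReal_le_ofReal ?_
  rw [integral_add (integrable_const A) (hi.const_mul B), integral_const, probReal_univ,
    one_smul, integral_const_mul]
  calc A + B * ∫ ω, X ω ^ 2 ∂P ≤ A + B * σ ^ 2 := by gcongr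
    _ = σ ^ p := by
      simp only [A, B]
      field_simp
      ring

section productMask

variable {d : ℕ} {ρ p σs σl : ℝ} {u : Vec d}

/-- By independence the variance of `⟨e, ·⟩` is the sum of the coordinate variances. -/
lemma integral_inner_sq_productMask_le (hρ : 0 < ρ) (hρ1 : ρ ≤ 1)
    (hmean : ∫ y, y ∂(productMask ρ u) = u) (hint : Integrable (fun y => y) (productMask ρ u))
    (e : Vec d) :
    Integrable (fun y => inner ℝ e (y - u) ^ 2) (productMask ρ u) ∧
    ∫ y, inner ℝ e (y - u) ^ 2 ∂(productMask ρ u) ≤ ∑ i, (e i) ^ 2 * ((u i) ^ 2 / ρ) := by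
  have := fun i => isProbabilityMeasure_bernoulliMask (u := u i) hρ.le hρ1
  have hmeas : Measurable (WithLp.toLp 2 : (Fin d → ℝ) → Vec d) := WithLp.measurable_toLp 2 _
  have hLp : ∀ i, MemLp (fun x => e i * x) 2 (bernoulliMask ρ (u i)) := fun i =>
    memLp_bernoulliMask (by fun_prop)
  have hP : IsProbabilityMeasure (productMask ρ u) :=
    Measure.isProbabilityMeasure_map hmeas.aemeasurable
  have hfun : (fun ω => inner ℝ e (WithLp.toLp 2 ω : Vec d))
      = ∑ i, fun ω : Fin d → ℝ => e i * ω i := by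
    funext ω
    simp [PiLp.inner_apply, mul_comm]
  have hinner : MemLp (fun y : Vec d => inner ℝ e y) 2 (productMask ρ u) := by
    rw [productMask, memLp_map_measure_iff (by fun_prop) hmeas.aemeasurable]
    change MemLp (fun ω => inner ℝ e (WithLp.toLp 2 ω : Vec d)) 2 _
    rw [hfun]
    exact memLp_finsetSum' _ fun i _ => (hLp i).comp_measurePreserving (measurePreserving_eval _ i)
  have hE : ∫ y, inner ℝ e y ∂(productMask ρ u) = inner ℝ e u := by
    rw [integral_inner hint, hmean]
  refine ⟨?_, ?_⟩
  · simp_rw [inner_sub_right]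
    exact (hinner.sub (memLp_const _)).integrable_sq
  · have h1 : ∫ y, inner ℝ e (y - u) ^ 2 ∂(productMask ρ u)
        = Var[fun y => inner ℝ e y; productMask ρ u] := by
      rw [variance_eq_integral hinner.aemeasurable, hE]
      simp_rw [inner_sub_right]
    rw [h1, productMask, variance_map (by fun_prop) hmeas.aemeasurable]
    change Var[fun ω => inner ℝ e (WithLp.toLp 2 ω : Vec d); _] ≤ _
    rw [hfun, variance_sum_pi hLp]
    exact Finset.sum_le_sum fun i _ => variance_bernoulliMask_le hρ hρ1 _

lemma productMask_coord (hρ : 0 < ρ) (hρ1 : ρ ≤ 1) {q : Set ℝ} (hq : MeasurableSet q)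
    (i : Fin d) : productMask ρ u {y | y i ∈ q} = bernoulliMask ρ (u i) q := by
  have := fun i => isProbabilityMeasure_bernoulliMask (u := u i) hρ.le hρ1
  have hset : MeasurableSet {y : Vec d | y i ∈ q} := hq.preimage (by fun_prop)
  rw [productMask, Measure.map_apply (WithLp.measurable_toLp 2 _) hset]
  exact (measurePreserving_eval (fun i => bernoulliMask ρ (u i)) i).measure_preimage
    hq.nullMeasurableSet

lemma isMask_productMask (hp : 0 ≤ p) (hp2 : p ≤ 2) (hρ : 0 < ρ) (hρ1 : ρ ≤ 1) (hσs : 0 < σs)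
    (hσl : 0 < σl) (hdir : ∀ i, (u i) ^ 2 / ρ ≤ σs ^ 2) (hnorm : ‖u‖ ^ 2 / ρ ≤ σl ^ 2) :
    IsMask (productMask ρ u) u p σs σl := by
  have := fun i => isProbabilityMeasure_bernoulliMask (u := u i) hρ.le hρ1
  have hmeas : Measurable (WithLp.toLp 2 : (Fin d → ℝ) → Vec d) := WithLp.measurable_toLp 2 _
  have hP : IsProbabilityMeasure (productMask ρ u) :=
    Measure.isProbabilityMeasure_map hmeas.aemeasurable
  have hev := fun i => measurePreserving_eval (fun i => bernoulliMask ρ (u i)) i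
  have hint_coord : ∀ i, Integrable (fun y : Vec d => y i) (productMask ρ u) := fun i => by
    rw [productMask, integrable_map_measure (by fun_prop) hmeas.aemeasurable]
    exact (hev i).integrable_comp_of_integrable (integrable_bernoulliMask fun x => x)
  have hint : Integrable (fun y => y) (productMask ρ u) := Integrable.of_eval_piLp hint_coord
  have hmean : ∫ y, y ∂(productMask ρ u) = u := by
    ext i
    rw [eval_integral_piLp hint_coord, productMask, integral_map hmeas.aemeasurable (by fun_prop)]
    refine (integral_comp_eval (μ := fun i => bernoulliMask ρ (u i)) (i := i)
      aestronglyMeasurable_id).trans ?_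
    simp only [id]
    rw [integral_bernoulliMask hρ.le hρ1]
    field_simp
    ring
  have hsq := integral_inner_sq_productMask_le hρ hρ1 hmean hint
  refine ⟨hP, hint, hmean, fun e he => ?_, ?_, ?_⟩
  · refine lintegral_rpow_le_of_integral_sq_le (fun _ => abs_nonneg _) hσs hp hp2 ?_ ?_
    · simpa only [sq_abs] using (hsq e).1
    · simp only [sq_abs]
      refine (hsq e).2.trans ?_
      calc _ ≤ ∑ i, (e i) ^ 2 * σs ^ 2 := by
            gcongr with i
            exact hdir i
        _ = σs ^ 2 := by
            rw [← Finset.sum_mul, ← EuclideanSpace.real_norm_sq_eq, he, one_pow, one_mul]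
  · have hdec : ∀ y : Vec d, ‖y - u‖ ^ 2
        = ∑ i, inner ℝ (EuclideanSpace.single i (1 : ℝ)) (y - u) ^ 2 := fun y => by
      simp [EuclideanSpace.real_norm_sq_eq, EuclideanSpace.inner_single_left]
    refine lintegral_rpow_le_of_integral_sq_le (fun _ => norm_nonneg _) hσl hp hp2 ?_ ?_
    · simp_rw [hdec]
      exact integrable_finsetSum _ fun i _ => (hsq _).1
    · simp_rw [hdec]
      rw [integral_finsetSum _ fun i _ => (hsq _).1]
      refine le_trans (Finset.sum_le_sum fun i _ => (hsq _).2) (le_trans (le_of_eq ?_) hnorm)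
      rw [EuclideanSpace.real_norm_sq_eq, Finset.sum_div]
      refine Finset.sum_congr rfl fun i _ => ?_
      simp
  · refine ae_all_iff.2 fun i => ?_
    by_cases hi : u i = 0
    · have hset : MeasurableSet ({0}ᶜ : Set ℝ) := (measurableSet_singleton 0).compl
      have h1 := productMask_coord (u := u) hρ hρ1 hset i
      rw [hi] at h1
      have h2 : bernoulliMask ρ 0 {0}ᶜ = 0 := by
        simp [bernoulliMask, Measure.dirac_apply' _ hset]
      rw [h2] at h1
      refine measure_mono_null ?_ h1
      intro y hy
      simpa [hi] using hy
    · exact ae_of_all _ fun y h => absurd h hi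

lemma productMask_ne_zero (hρ : 0 < ρ) (hρ1 : ρ ≤ 1) (i : Fin d) :
    productMask ρ u {y | y i ≠ 0} ≤ ENNReal.ofReal ρ :=
  (productMask_coord hρ hρ1 (measurableSet_singleton (0 : ℝ)).compl i).le.trans bernoulliMask_ne_zero

end productMask

/-! ### Choice of the parameters and the two rates -/

section rates

variable {d T : ℕ} {D G μ p σs σl δ : ℝ}

/-- Masks on `M` that reveal each coordinate with probability at most `ρ`, for all sufficiently
small slopes. -/
lemma exists_isMask_flatVec {M : Finset (Fin d)} (hM0 : M.Nonempty) {ρ : ℝ} (hρ : 0 < ρ)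
    (hρ1 : ρ ≤ 1) (hp : 1 < p) (hp2 : p ≤ 2) (hσs : 0 < σs) (hσ : √M.card * σs ≤ σl) :
    ∃ K : ℝ, 0 < K ∧ σs ^ 2 / 4 * (M.card * ρ) ^ (2 - 2 / p) ≤ M.card * K ^ 2 ∧
      ∀ b, 0 ≤ b → b ≤ K → ∃ P : Measure (Vec d), IsMask P (flatVec M b) p σs σl ∧
        ∀ i, P {y | y i ≠ 0} ≤ ENNReal.ofReal ρ := by
  have hm : (0 : ℝ) < M.card := by exact_mod_cast hM0.card_pos
  have hp0 : 0 < p := by linarith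
  rcases le_total ((M.card : ℝ) * ρ) 1 with hMρ | hMρ
  -- This `K` gives equality in the moment condition of the spread mask.
  · set K := σs / 2 * ρ ^ ((p - 1) / p) * (M.card : ℝ) ^ (-(1 - p / 2) / p) with hK
    have hK0 : 0 < K := by positivity
    refine ⟨K, hK0, le_of_eq ?_, fun b hb hbK => ⟨sparseMask M ρ b,
      isMask_sparseMask_spread hp.le hp2 hρ hM0 hMρ hb hσs.le hσ ?_, sparseMask_ne_zero⟩⟩
    · rw [hK, mul_pow, mul_pow, ← Real.rpow_natCast (ρ ^ _), ← Real.rpow_natCast ((M.card : ℝ) ^ _),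
        ← Real.rpow_mul hρ.le, ← Real.rpow_mul hm.le, Real.mul_rpow hm.le hρ.le]
      have h1 : (M.card : ℝ) ^ (2 - 2 / p)
          = M.card * (M.card : ℝ) ^ (-(1 - p / 2) / p * ((2 : ℕ) : ℝ)) := by
        have h3 : 2 - 2 / p = 1 + -(1 - p / 2) / p * ((2 : ℕ) : ℝ) := by
          push_cast; field_simp; ring
        rw [h3, Real.rpow_add hm, Real.rpow_one]
      have h2 : 2 - 2 / p = (p - 1) / p * ((2 : ℕ) : ℝ) := by push_cast; field_simp
      rw [h1, ← h2]
      ring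
    · calc b ^ p * ρ ^ (1 - p) * (M.card : ℝ) ^ (1 - p / 2)
          ≤ K ^ p * ρ ^ (1 - p) * (M.card : ℝ) ^ (1 - p / 2) := by gcongr
        _ = (σs / 2) ^ p := by
          rw [hK, Real.mul_rpow (by positivity) (by positivity),
            Real.mul_rpow (by positivity) (by positivity), ← Real.rpow_mul hρ.le,
            ← Real.rpow_mul hm.le, div_mul_cancel₀ _ hp0.ne', div_mul_cancel₀ _ hp0.ne',
            show p - 1 = -(1 - p) by ring, Real.rpow_neg hρ.le, Real.rpow_neg hm.le]
          field_simp
  -- When `M.card * ρ ≥ 1` the sparse mask lacks the room to reveal coordinates disjointly.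
  -- Independent reveals with second moments suffice, since `2 - 2 / p ≤ 1` gives `(M.card * ρ) ^ (2
  -- - 2 / p) ≤ M.card * ρ`.
  · have hK0 : 0 < σs * √ρ := by positivity
    have hσl : 0 < σl := lt_of_lt_of_le (by positivity) hσ
    refine ⟨σs * √ρ, hK0, ?_, fun b hb hbK => ⟨productMask ρ (flatVec M b),
      isMask_productMask hp0.le hp2 hρ hρ1 hσs hσl (fun i => ?_) ?_, productMask_ne_zero hρ hρ1⟩⟩
    · rw [mul_pow, Real.sq_sqrt hρ.le]
      have h1 : (M.card * ρ) ^ (2 - 2 / p) ≤ M.card * ρ := by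
        refine (Real.rpow_le_rpow_of_exponent_le hMρ ?_).trans_eq (Real.rpow_one _)
        have : 1 ≤ 2 / p := by rwa [one_le_div hp0]
        linarith
      nlinarith [mul_le_mul_of_nonneg_left h1 (sq_nonneg σs), mul_pos (pow_pos hσs 2) (mul_pos hm hρ)]
    · have h1 : b ^ 2 ≤ σs ^ 2 * ρ := by
        calc b ^ 2 ≤ (σs * √ρ) ^ 2 := by gcongr
          _ = σs ^ 2 * ρ := by rw [mul_pow, Real.sq_sqrt hρ.le]
      rw [div_le_iff₀ hρ, flatVec_apply]
      split_ifs
      · exact h1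
      · rw [zero_pow two_ne_zero]; positivity
    · rw [div_le_iff₀ hρ, norm_flatVec_sq]
      calc M.card * b ^ 2 ≤ M.card * (σs * √ρ) ^ 2 := by gcongr
        _ = (√M.card * σs) ^ 2 * ρ := by
          rw [mul_pow, mul_pow, Real.sq_sqrt hρ.le, Real.sq_sqrt hm.le]; ring
        _ ≤ σl ^ 2 * ρ := by gcongr

lemma rate_eq (hσs : 0 < σs) (hσl : 0 < σl) :
    σs ^ 2 * (σl ^ 2 / σs ^ 2) ^ (2 - 2 / p) = σs ^ (4 / p - 2) * σl ^ (4 - 4 / p) := by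
  rw [Real.div_rpow (by positivity) (by positivity), ← Real.rpow_natCast σs 2,
    ← Real.rpow_natCast σl 2, ← Real.rpow_mul hσs.le, ← Real.rpow_mul hσl.le,
    show 4 / p - 2 = ((2 : ℕ) : ℝ) - ((2 : ℕ) : ℝ) * (2 - 2 / p) by push_cast; ring,
    Real.rpow_sub hσs,
    show 4 - 4 / p = ((2 : ℕ) : ℝ) * (2 - 2 / p) by push_cast; ring]
  ring

/-- The dimension-dependent part of the lower bound. -/
theorem spread_le_minimaxStr (hD : 0 < D) (hG : 0 < G) (hμ : 0 < μ) (hp : 1 < p) (hp2 : p ≤ 2)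
    (hσs : 0 < σs) (hσ : σs ≤ σl) (hd : σl ^ 2 / σs ^ 2 ≤ d) (hT : 1 ≤ T) (hδ : δ < 1 / 10) :
    ENNReal.ofReal (1 / 128 * min (μ * D ^ 2) (min (G ^ 2 / μ)
      (σs ^ (4 / p - 2) * σl ^ (4 - 4 / p) / (μ * (T : ℝ) ^ (2 - 2 / p)))))
      ≤ minimaxStr d T D G μ p σs σl δ := by
  have hσl : 0 < σl := hσs.trans_le hσ
  have hp0 : 0 < p := by linarith
  have hT1 : (1 : ℝ) ≤ T := by exact_mod_cast hT
  have hT0 : (0 : ℝ) < T := by linarith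
  set q := σl ^ 2 / σs ^ 2 with hq
  have hq1 : 1 ≤ q := by
    rw [hq, one_le_div (by positivity)]
    gcongr
  obtain ⟨M, -, hMcard⟩ : ∃ M : Finset (Fin d), M ⊆ Finset.univ ∧ M.card = ⌊q⌋₊ :=
    Finset.exists_subset_card_eq (by simpa using Nat.floor_le_of_le hd)
  have hfl1 : 1 ≤ ⌊q⌋₊ := Nat.one_le_floor_iff q |>.2 hq1
  have hM0 : M.Nonempty := Finset.card_pos.1 (by omega)
  have hm1 : (1 : ℝ) ≤ M.card := by rw [hMcard]; exact_mod_cast hfl1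
  have hmq : (M.card : ℝ) ≤ q := by rw [hMcard]; exact Nat.floor_le (by linarith)
  have hqm : q ≤ 2 * M.card := by
    have := Nat.lt_floor_add_one q
    rw [hMcard] at hm1 ⊢
    linarith
  have hsqrt : √M.card * σs ≤ σl := by
    rw [← le_div_iff₀ hσs]
    refine Real.sqrt_le_iff.2 ⟨by positivity, ?_⟩
    rwa [div_pow]
  have hρ : (0 : ℝ) < 1 / (4 * T) := by positivity
  have hρ1 : (1 : ℝ) / (4 * T) ≤ 1 := by rw [div_le_one (by positivity)]; linarith
  obtain ⟨K, hK0, hK, hmask⟩ := exists_isMask_flatVec hM0 hρ hρ1 hp hp2 hσs hsqrt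
  set B := min G (μ * D) with hB
  have hB0 : 0 < B := lt_min hG (by positivity)
  have hs0 : 0 < √(M.card : ℝ) := Real.sqrt_pos.2 (by linarith)
  -- The first bound keeps `‖u‖ = √M.card * b` below `B`, the second keeps the mask admissible.
  set b := min (B / √M.card) K with hb
  have hb0 : 0 ≤ b := by positivity
  obtain ⟨P, hP, hP0⟩ := hmask b hb0 (min_le_right _ _)
  have hu : ‖flatVec M b‖ ≤ B := by
    rw [norm_flatVec hb0, ← le_div_iff₀' hs0]
    exact min_le_left _ _
  refine le_trans (ENNReal.ofReal_le_ofReal ?_) (hP.le_minimaxStr_of_prob_ne_zero hp0 hμ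
    (hu.trans (min_le_left _ _)) (hu.trans (min_le_right _ _)) hT hδ hP0)
  rw [norm_flatVec_sq]
  have ha0 : 0 ≤ 2 - 2 / p := by
    have : 2 / p ≤ 2 := by rw [div_le_iff₀ hp0]; linarith
    linarith
  have ha1 : 2 - 2 / p ≤ 1 := by
    have : 1 ≤ 2 / p := by rwa [one_le_div hp0]
    linarith
  set S := σs ^ (4 / p - 2) * σl ^ (4 - 4 / p) with hS
  set m := min (μ * D ^ 2) (min (G ^ 2 / μ) (S / (μ * (T : ℝ) ^ (2 - 2 / p)))) with hm
  have hm0 : 0 ≤ m := by positivity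
  have hmD : m ≤ μ * D ^ 2 := min_le_left _ _
  have hmG : m ≤ G ^ 2 / μ := (min_le_right _ _).trans (min_le_left _ _)
  have hmS : m ≤ S / (μ * (T : ℝ) ^ (2 - 2 / p)) := (min_le_right _ _).trans (min_le_right _ _)
  have hmB : μ * m ≤ B ^ 2 := by
    rcases min_choice G (μ * D) with h | h <;> rw [hB, h]
    · rwa [le_div_iff₀' hμ] at hmG
    · nlinarith
  -- The factor `32` is `4` from `K` times `8`, where `8` comes from `ρ = 1 / (4 * T)` and from
  -- rounding `q` down.
  have hmK : μ * m / 32 ≤ M.card * K ^ 2 := by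
    refine le_trans ?_ hK
    have h1 : μ * m ≤ S / (T : ℝ) ^ (2 - 2 / p) := by
      rw [mul_comm μ (_ ^ _), ← div_div, le_div_iff₀' hμ] at hmS
      exact hmS
    have h2 : q / T / 8 ≤ M.card * (1 / (4 * T)) := by
      rw [show (M.card : ℝ) * (1 / (4 * T)) = 2 * M.card / T / 8 by field_simp; norm_num]
      gcongr
    have h3 : (q / T) ^ (2 - 2 / p) / 8 ≤ (M.card * (1 / (4 * T)) : ℝ) ^ (2 - 2 / p) := by
      refine le_trans ?_ (Real.rpow_le_rpow (by positivity) h2 ha0)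
      rw [Real.div_rpow (x := q / T) (y := 8) (by positivity) (by norm_num)]
      gcongr
      exact (Real.rpow_le_rpow_of_exponent_le (by norm_num) ha1).trans_eq (Real.rpow_one _)
    rw [Real.div_rpow (by positivity) hT0.le] at h3
    rw [hS, ← rate_eq hσs hσl, ← hq] at h1
    calc μ * m / 32 ≤ σs ^ 2 * q ^ (2 - 2 / p) / (T : ℝ) ^ (2 - 2 / p) / 32 := by gcongr
      _ = σs ^ 2 / 4 * (q ^ (2 - 2 / p) / (T : ℝ) ^ (2 - 2 / p) / 8) := by ring
      _ ≤ _ := by gcongr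
  have hfin : μ * m / 32 ≤ M.card * b ^ 2 := by
    rcases min_choice (B / √M.card) K with h | h <;> rw [hb, h]
    · rw [div_pow, Real.sq_sqrt (by linarith), mul_div_cancel₀ _ (by linarith)]
      have : 0 ≤ μ * m := by positivity
      linarith
    · exact hmK
  rw [div_div, le_div_iff₀ (by positivity)]
  linarith

/-- The confidence-dependent part of the lower bound. -/
theorem confidence_le_minimaxStr (hD : 0 < D) (hG : 0 < G) (hμ : 0 < μ) (hp : 1 < p) (hp2 : p ≤ 2)
    (hσs : 0 < σs) (hσ : σs ≤ σl) (hd : 0 < d) (hT : 1 ≤ T) (hδ0 : 0 < δ)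
    (hδ : δ < 1 / 10) :
    ENNReal.ofReal (1 / 128 * min (μ * D ^ 2) (min (G ^ 2 / μ)
      (σs ^ 2 * Real.log (1 / (8 * δ)) ^ (2 - 2 / p) / (μ * (T : ℝ) ^ (2 - 2 / p)))))
      ≤ minimaxStr d T D G μ p σs σl δ := by
  have hp0 : 0 < p := by linarith
  have hT0 : (0 : ℝ) < T := by exact_mod_cast hT
  have hlog : 0 < Real.log (1 / (8 * δ)) := Real.log_pos (by
    rw [lt_div_iff₀ (by positivity)]; linarith)
  -- `x = exp (-L)` is the probability of hiding the coordinate in one round, so that it stays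
  -- hidden for `T` rounds with probability `8 * δ > 2 * δ`.
  set L := Real.log (1 / (8 * δ)) / T with hL
  have hL0 : 0 < L := by positivity
  set x := Real.exp (-L) with hx
  have hx0 : 0 < x := Real.exp_pos _
  have hx1 : x < 1 := by rw [hx]; simpa using hL0
  have hρ : 0 < 1 - x := by linarith
  have hxT : x ^ T = 8 * δ := by
    rw [hx, ← Real.exp_nat_mul, hL, mul_neg, mul_div_cancel₀ _ hT0.ne', ← Real.log_inv,
      Real.exp_log (by positivity)]
    simp
  set B := min G (μ * D) with hB
  have hB0 : 0 < B := lt_min hG (by positivity)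
  set K := σs / 2 * L ^ ((p - 1) / p) with hK
  have hK0 : 0 < K := by positivity
  set b := min B K with hb
  have hb0 : 0 ≤ b := by positivity
  -- When `L` is large, `b` may exceed `σs`. The sharp moment formula allows this, because the noise
  -- vanishes as `x` tends to `0`.
  have hbound : b ^ p * ((1 - (1 - x)) + (1 - x) ^ (1 - p) * (1 - (1 - x)) ^ p) ≤ σs ^ p := by
    rw [sub_sub_cancel]
    have h1 : b ^ p ≤ (σs / 2) ^ p * L ^ (p - 1) := by
      calc b ^ p ≤ K ^ p := by gcongr; exact min_le_right _ _
        _ = (σs / 2) ^ p * L ^ (p - 1) := by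
          rw [hK, Real.mul_rpow (by positivity) (by positivity), ← Real.rpow_mul hL0.le,
            div_mul_cancel₀ _ hp0.ne']
    -- This is `1 + L ≤ exp L`; it trades the growth of `L ^ (p - 1)` against the small factor `x`.
    have h2 : L * x ≤ 1 - x := by
      have h3 := Real.add_one_le_exp L
      have h4 : Real.exp L * x = 1 := by rw [hx, ← Real.exp_add]; simp
      nlinarith
    have h5 : L ^ (p - 1) * x ≤ (1 - x) ^ (p - 1) := by
      calc L ^ (p - 1) * x ≤ L ^ (p - 1) * x ^ (p - 1) := by
            gcongr
            simpa using Real.rpow_le_rpow_of_exponent_ge hx0 hx1.le (by linarith : p - 1 ≤ 1)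
        _ = (L * x) ^ (p - 1) := (Real.mul_rpow hL0.le hx0.le).symm
        _ ≤ (1 - x) ^ (p - 1) := Real.rpow_le_rpow (by positivity) h2 (by linarith)
    have h6 : (1 - x) ^ (p - 1) * (1 - x) ^ (1 - p) = 1 := by
      rw [← Real.rpow_add hρ]; simp
    have h7 : L ^ (p - 1) * x * (1 - x) ^ (1 - p) ≤ 1 := by
      exact (mul_le_mul_of_nonneg_right h5 (by positivity)).trans_eq h6
    have h8 : x ^ p ≤ x := by
      simpa using Real.rpow_le_rpow_of_exponent_ge hx0 hx1.le hp.le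
    have h9 : 1 ≤ (1 - x) ^ (1 - p) :=
      Real.one_le_rpow_of_pos_of_le_one_of_nonpos hρ (by linarith) (by linarith)
    have h10 : (2 : ℝ) ≤ 2 ^ p := by
      simpa using Real.rpow_le_rpow_of_exponent_le one_le_two hp.le
    calc b ^ p * (x + (1 - x) ^ (1 - p) * x ^ p)
        ≤ ((σs / 2) ^ p * L ^ (p - 1)) * (x * (1 - x) ^ (1 - p) + (1 - x) ^ (1 - p) * x) := by
          gcongr
          exact le_mul_of_one_le_right hx0.le h9
      _ = (σs / 2) ^ p * (2 * (L ^ (p - 1) * x * (1 - x) ^ (1 - p))) := by ring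
      _ ≤ (σs / 2) ^ p * (2 * 1) := by gcongr
      _ ≤ (σs / 2) ^ p * 2 ^ p := by gcongr; linarith
      _ = σs ^ p := by
          rw [← Real.mul_rpow (by positivity) two_pos.le, div_mul_cancel₀ _ two_ne_zero]
  have hP := isMask_sparseMask_single hp0.le hρ (by linarith) hb0 (⟨0, hd⟩ : Fin d) hσs.le hσ hbound
  have hnorm : ‖flatVec {(⟨0, hd⟩ : Fin d)} b‖ = b := by simp [norm_flatVec hb0]
  have hzero : ENNReal.ofReal (2 * δ) < sparseMask {(⟨0, hd⟩ : Fin d)} (1 - x) b {0} ^ T := by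
    have h1 := le_sparseMask_zero (M := {(⟨0, hd⟩ : Fin d)}) (ρ := 1 - x) (b := b)
    rw [Finset.card_singleton, Nat.cast_one, one_mul, sub_sub_cancel] at h1
    refine lt_of_lt_of_le ?_ (pow_le_pow_left₀ zero_le h1 T)
    rw [← ENNReal.ofReal_pow hx0.le, hxT]
    exact (ENNReal.ofReal_lt_ofReal_iff (by positivity)).2 (by linarith)
  have hbB : b ≤ B := min_le_left _ _
  refine le_trans (ENNReal.ofReal_le_ofReal ?_) (hP.le_minimaxStr_of_singleton_zero hp0 hμ
    (by rw [hnorm]; exact hbB.trans (min_le_left _ _))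
    (by rw [hnorm]; exact hbB.trans (min_le_right _ _)) hzero)
  rw [hnorm]
  set m := min (μ * D ^ 2) (min (G ^ 2 / μ)
    (σs ^ 2 * Real.log (1 / (8 * δ)) ^ (2 - 2 / p) / (μ * (T : ℝ) ^ (2 - 2 / p)))) with hm
  have hm0 : 0 ≤ m := by positivity
  have hmD : m ≤ μ * D ^ 2 := min_le_left _ _
  have hmG : m ≤ G ^ 2 / μ := (min_le_right _ _).trans (min_le_left _ _)
  have hmS := (min_le_right (μ * D ^ 2) _).trans (min_le_right (G ^ 2 / μ)
    (σs ^ 2 * Real.log (1 / (8 * δ)) ^ (2 - 2 / p) / (μ * (T : ℝ) ^ (2 - 2 / p))))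
  rw [← hm] at hmS
  have hfin : μ * m / 4 ≤ b ^ 2 := by
    have hμm : 0 ≤ μ * m := by positivity
    rcases min_choice B K with h | h <;> rw [hb, h]
    · rcases min_choice G (μ * D) with h | h <;> rw [hB, h]
      · rw [le_div_iff₀' hμ] at hmG
        linarith
      · nlinarith
    · have h1 : K ^ 2 = σs ^ 2 / 4 * L ^ (2 - 2 / p) := by
        rw [hK, mul_pow, ← Real.rpow_natCast (L ^ _), ← Real.rpow_mul hL0.le,
          show 2 - 2 / p = (p - 1) / p * ((2 : ℕ) : ℝ) by push_cast; field_simp]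
        ring
      rw [h1, hL, Real.div_rpow hlog.le hT0.le]
      rw [mul_comm μ (_ ^ _), ← div_div, le_div_iff₀' hμ] at hmS
      calc μ * m / 4 ≤ σs ^ 2 * Real.log (1 / (8 * δ)) ^ (2 - 2 / p)
            / (T : ℝ) ^ (2 - 2 / p) / 4 := by gcongr
        _ = _ := by ring
  rw [le_div_iff₀ (by positivity)]
  nlinarith [mul_nonneg hμ.le hm0]

end rates

end HeavyTailLB

end

theorem mainTheorem8 :
    ∃ c : ℝ, 0 < c ∧
      ∀ (D G μ p σs σl δ : ℝ) (d T : ℕ),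
        0 < D → 0 < G → 0 < μ → 1 < p → p ≤ 2 → 0 < σs → σs ≤ σl →
        σl ^ 2 / σs ^ 2 ≤ (d : ℝ) → 1 ≤ T → 0 < δ → δ < 1 / 10 →
        ENNReal.ofReal (c *
          min (μ * D ^ 2)
            (min (G ^ 2 / μ)
              (min (σs ^ (4 / p - 2) * σl ^ (4 - 4 / p) / μ)
                ((σs ^ (4 / p - 2) * σl ^ (4 - 4 / p)
                    + σs ^ 2 * Real.log (1 / (8 * δ)) ^ (2 - 2 / p))
                  / (μ * (T : ℝ) ^ (2 - 2 / p))))))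
          ≤ HeavyTailLB.minimaxStr d T D G μ p σs σl δ := by
  refine ⟨1 / 256, by norm_num, fun D G μ p σs σl δ d T hD hG hμ hp hp2 hσs hσ hd hT hδ0 hδ => ?_⟩
  have hσl : 0 < σl := hσs.trans_le hσ
  have hd0 : 0 < d := by
    have : (0 : ℝ) < d := lt_of_lt_of_le (by positivity) hd
    exact_mod_cast this
  have hT0 : (0 : ℝ) < T := by exact_mod_cast hT
  set S := σs ^ (4 / p - 2) * σl ^ (4 - 4 / p)
  set R := σs ^ 2 * Real.log (1 / (8 * δ)) ^ (2 - 2 / p)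
  set q := μ * (T : ℝ) ^ (2 - 2 / p)
  have hq : 0 < q := by positivity
  -- `Y` will be the larger of `S` and `R`, which costs the factor `2` between `1/128` and `1/256`.
  -- The term `S / μ` is only discarded from the minimum.
  have key : ∀ Y : ℝ, S + R ≤ 2 * Y → 1 / 256 * min (μ * D ^ 2) (min (G ^ 2 / μ)
      (min (S / μ) ((S + R) / q))) ≤ 1 / 128 * min (μ * D ^ 2) (min (G ^ 2 / μ) (Y / q)) := by
    intro Y hY
    set m := min (μ * D ^ 2) (min (G ^ 2 / μ) (min (S / μ) ((S + R) / q))) with hm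
    have h1 : m ≤ μ * D ^ 2 := min_le_left _ _
    have h2 : m ≤ G ^ 2 / μ := (min_le_right _ _).trans (min_le_left _ _)
    have h3 : m ≤ (S + R) / q :=
      (min_le_right _ _).trans ((min_le_right _ _).trans (min_le_right _ _))
    have h4 : (S + R) / q ≤ 2 * (Y / q) := by
      rw [← mul_div_assoc]; gcongr
    have h5 : 0 < μ * D ^ 2 := by positivity
    have h6 : 0 < G ^ 2 / μ := by positivity
    have h7 : m / 2 ≤ min (μ * D ^ 2) (min (G ^ 2 / μ) (Y / q)) :=
      le_min (by linarith) (le_min (by linarith) (by linarith))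
    linarith
  rcases le_total R S with h | h
  · exact (ENNReal.ofReal_le_ofReal (key S (by linarith))).trans
      (HeavyTailLB.spread_le_minimaxStr hD hG hμ hp hp2 hσs hσ hd hT hδ)
  · exact (ENNReal.ofReal_le_ofReal (key R (by linarith))).trans
      (HeavyTailLB.confidence_le_minimaxStr hD hG hμ hp hp2 hσs hσ hd0 hT hδ0 hδ)
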